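/- Let $\mathcal X\subset\mathbb R^d$ and $\mathcal Y\subset\mathbb R$ be compact, and let $\ell:\mathcal Y\times\mathcal Y\to\mathbb R$ be $L_\ell$-Lipschitz, $L_\ell>0$. Let $\mu$ be a probability measure on $\mathcal X\times\mathcal Y\subset\mathbb R^{d+1}$ such that the data lie almost surely on a $\tilde d$-dimensional compact $C^1$ manifold $\mathcal M$ embedded in $\mathbb R^{d+1}$ (with the Riemannian metric induced from $\mathbb R^{d+1}$), where $\tilde d\ge 3$. Let $(x_1,y_1),\dots,(x_N,y_N)$, $N\ge 1$, be i.i.d. draws from $\mu$, and let $\hat f^N:\mathcal X\to\mathcal Y$ be a learned function, which may depend on the sample and almost surely satisfies $\mathrm{Lip}(\hat f^N\,|\,\mathcal X)\le L_{\hat f}$ for a constant $L_{\hat f}>0$. Here $\mathrm{Lip}(g\,|\,S)=\sup\{|g(x)-g(x')|/\|x-x'\|_2 : x\ne x'\in S\}$. Let $$\mathfrak R(\hat f^N;\mu)=\int \ell(\hat f^N(x),y)\,\mu(dx,dy),\qquad \hat{\mathfrak R}(\hat f^N)=\frac1N\sum_{n=1}^N\ell(\hat f^N(x_n),y_n).$$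 There is a constant $C(\tilde d)=C(\tilde d,\mathcal M)>0$, which depends only on the manifold $\mathcal M\subset\mathbb R^{d+1}$ (and so on its dimension), but not on $\mathcal X,\mathcal Y,\ell,\mu,N,\delta,\boldsymbol P,\hat f^N$, with the following property. For every $0<\delta\le 1$ and every data-independent partitioning $\boldsymbol P$ of $\mathcal X\times\mathcal Y$ into finitely many measurable parts, if $\ell\ge 0$, then with probability greater than $1-\delta$ $$\mathfrak R(\hat f^N;\mu)-\hat{\mathfrak R}(\hat f^N)\le \frac{C(\tilde d)L_\ell}{N}\sum_{P\in\boldsymbol P}N_P^{1-1/\tilde d}\max\{1,\mathrm{Lip}(\hat f^N|P_{\mathcal X})\}\,\mathrm{diam}(P)+\mathrm{err}_{\mathrm{transport}}(\boldsymbol P)+\mathrm{cost}_{\mathrm{partition}}(\boldsymbol P),$$ where $N_P$ is the number of sample points in $P$, $P_{\mathcal X}$ is the projection of $P$ to $\mathcal X$, $\mathrm{diam}$ is the Euclidean diameter in $\mathbb R^{d+1}$, $$\mathrm{err}_{\mathrm{transport}}(\boldsymbol P)=\sqrt{\frac{\ln(4/\delta)}{N}}\,L_\ell\max\{1,L_{\hat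 f}\}\max_{P\in\boldsymbol P}\mathrm{diam}(P),$$ $$\mathrm{cost}_{\mathrm{partition}}(\boldsymbol P)=\begin{cases}\|\ell\|_\infty\max\left\{\sqrt{\frac{2\ln(4/\delta)}{N}},\sqrt{\frac{|\boldsymbol P|}{N}}\right\}&|\boldsymbol P|>1,\\ 0&|\boldsymbol P|=1.\end{cases}$$ For a loss $\ell$ of arbitrary sign the same holds with $2\,\mathrm{cost}_{\mathrm{partition}}(\boldsymbol P)$ in place of $\mathrm{cost}_{\mathrm{partition}}(\boldsymbol P)$. Thus the exponent of $N_P$ depends only on the intrinsic dimension $\tilde d$, and not on $d$. -/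

import Mathlib

open MeasureTheory ProbabilityTheory Manifold
open scoped ENNReal

noncomputable section

/-- The space `ℝ^d × ℝ` of pairs `(x, y)` with the Euclidean norm
`‖(x, y)‖ = √(‖x‖² + y²)`, that is, a copy of `ℝ^(d+1)`. -/
abbrev DataSpace (d : ℕ) : Type := WithLp 2 (EuclideanSpace ℝ (Fin d) × ℝ)

/-- The set `X × Y` inside the Euclidean space `ℝ^d × ℝ`. -/
def dataDomain {d : ℕ} (X : Set (EuclideanSpace ℝ (Fin d))) (Y : Set ℝ) : Set (DataSpace d) :=
  {z | z.fst ∈ X ∧ z.snd ∈ Y}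

/-- `(P i)` is a partitioning of `A` into `k` measurable parts. Parts may be empty. -/
structure IsPartitioning {d k : ℕ} (P : Fin k → Set (DataSpace d)) (A : Set (DataSpace d)) :
    Prop where
  measurableSet : ∀ i, MeasurableSet (P i)
  disjoint : ∀ i j, i ≠ j → Disjoint (P i) (P j)
  iUnion_eq : ⋃ i, P i = A

/-- The local Lipschitz constant `Lip(g | S)`, the supremum of `|g x₁ - g x₂| / ‖x₁ - x₂‖` over
pairs of distinct points of `S`, as an extended nonnegative number: it is `∞` exactly when
the quotients are unbounded. -/
def lipConst {d : ℕ} (g : EuclideanSpace ℝ (Fin d) → ℝ) (S : Set (EuclideanSpace ℝ (Fin d))) :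
    ℝ≥0∞ :=
  ⨆ x₁ ∈ S, ⨆ x₂ ∈ S, ⨆ _ : x₁ ≠ x₂, ENNReal.ofReal (|g x₁ - g x₂| / ‖x₁ - x₂‖)

/-- The loss is `L`-Lipschitz on `Y × Y`, for the Euclidean norm. -/
def IsLipschitzLoss (ℓ : ℝ → ℝ → ℝ) (Y : Set ℝ) (L : ℝ) : Prop :=
  ∀ a ∈ Y, ∀ b ∈ Y, ∀ a' ∈ Y, ∀ b' ∈ Y,
    |ℓ a b - ℓ a' b'| ≤ L * √((a - a') ^ 2 + (b - b') ^ 2)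

/-- The supremum norm of the loss on `Y × Y`. -/
def lossSupNorm (ℓ : ℝ → ℝ → ℝ) (Y : Set ℝ) : ℝ :=
  sSup ((fun p : ℝ × ℝ => |ℓ p.1 p.2|) '' (Y ×ˢ Y))

/-- The expected risk of the predictor `f`. -/
def expectedRisk {d : ℕ} (ℓ : ℝ → ℝ → ℝ) (f : EuclideanSpace ℝ (Fin d) → ℝ)
    (μ : Measure (DataSpace d)) : ℝ :=
  ∫ z, ℓ (f z.fst) z.snd ∂μ

/-- The empirical risk of the predictor `f` on the sample `D`. -/
def empiricalRisk {d N : ℕ} (ℓ : ℝ → ℝ → ℝ) (f : EuclideanSpace ℝ (Fin d) → ℝ)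
    (D : Fin N → DataSpace d) : ℝ :=
  (1 / (N : ℝ)) * ∑ n, ℓ (f (D n).fst) (D n).snd

open Classical in
/-- The number of sample points that fall into `S`. -/
def sampleCount {d N : ℕ} (D : Fin N → DataSpace d) (S : Set (DataSpace d)) : ℕ :=
  (Finset.univ.filter fun n => D n ∈ S).card

/-- The transport cost with intrinsic dimension `m` and constant `C`:
`(C L_ℓ / N) ∑_P N_P^(1 - 1/m) max{1, Lip(f | P_X)} diam(P)`. -/
def transportCost {d N k : ℕ} (C Lℓ : ℝ) (m : ℕ) (f : EuclideanSpace ℝ (Fin d) → ℝ)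
    (D : Fin N → DataSpace d) (P : Fin k → Set (DataSpace d)) : ℝ :=
  C * Lℓ / N * ∑ i, (sampleCount D (P i) : ℝ) ^ (1 - 1 / (m : ℝ)) *
    max 1 (lipConst f ((fun z : DataSpace d => z.fst) '' P i)).toReal * Metric.diam (P i)

/-- The deviation of the transport cost:
`√(ln(4/δ) / N) L_ℓ max{1, L_f} max_P diam(P)`. -/
def transportErr {d k : ℕ} (N : ℕ) (Lℓ Lf δ : ℝ) (P : Fin k → Set (DataSpace d)) : ℝ :=
  √(Real.log (4 / δ) / N) * Lℓ * max 1 Lf * ⨆ i, Metric.diam (P i)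

/-- The cost of a partitioning into `k` parts for a loss of sup norm `B`:
`B max{√(2 ln(4/δ) / N), √(k / N)}` if `k > 1`, and `0` if `k = 1`. -/
def partitionCost (N k : ℕ) (B δ : ℝ) : ℝ :=
  if 1 < k then B * max √(2 * Real.log (4 / δ) / N) √((k : ℝ) / N) else 0

end

/-! Since the predictor depends on the sample, the gap is bounded uniformly over all functions that
are Lipschitz on each cell. On a cell `P i` the integrand `g(z) = ℓ(f(x), y)` is Lipschitz with
constant `Λ i = L_ℓ max{1, Lip(f | P_X)}`. With `n_i` sample points in the cell and `M i` the
conditional mean of `g` there, the gap splits as `∑ (μ(P i) - n_i / N) M i + (1/N) ∑_i ∑_{D n ∈ P i}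
(M i - g(D n))`. The first sum involves only cell frequencies. In the second, the sum over cell `i`
is at most `Λ i` times the Lipschitz discrepancy `lipDisc`, which does not mention `f`.

Expected discrepancy: a compact immersed `m`-manifold is covered by finitely many bi-Lipschitz
charts, so each subset of diameter at most `d` has `d / 2^j`-nets of size `K 2^(j m)`, with `K`
independent of the subset and of the scale. Chaining over these nets (`integral_lipDisc_le`) gives
mean discrepancy of order `d n^(1 - 1/m)`; `m ≥ 3` makes the finest scale dominate. The final
constant depends on `K` and `m` only.

Fluctuations: conditionally on which cell each sample point falls into, the points are independent
and each follows the law of its cell, so the cell discrepancies are independent. By McDiarmid, each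
discrepancy divided by the diameter is sub-Gaussian with variance proxy `n_i / 4`. Enlarging the
constant by `3` gives the excess `x_i` (`discExcess`) mean at most `-3 n_i^(2/3)`, so that positive
parts are rare and can be summed over many cells without a logarithmic loss.

Let `s = √(ln(4/δ) / N)`, and let `t` be the maximum in the partition cost. Three events suffice
(`GoodSample`). In cells with `10 s n_i > 1` the positive parts of `x_i` add up to at most `N s`,
which gives the transport error. In the other cells a positive excess is charged the full range `B`
of the loss per sample point, and such cells hold at most `t N / 5` points. The frequencies deviate
by at most `4 t / 5` on every union of cells. The last two costs add up to `B t`, and each event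
fails with probability at most `exp(-N s²) = δ / 4`. -/

set_option linter.unusedSectionVars false

/-! ### Bounded differences and independence of coordinate blocks. -/

theorem integral_exp_sub_integral_le_of_osc {E : Type*} [MeasurableSpace E] (ν : Measure E)
    [IsProbabilityMeasure ν] (G : E → ℝ) (hG : Measurable G) (M : ℝ) (hM : ∀ x, |G x| ≤ M)
    (c : ℝ) (hc : ∀ x y, |G x - G y| ≤ c) :
    ∫ z, Real.exp (G z - ∫ x, G x ∂ν) ∂ν ≤ Real.exp (c ^ 2 / 8) := by
  have hne : Nonempty E := ν.nonempty_of_neZero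
  have hbdd : BddBelow (Set.range G) := ⟨-M, by rintro _ ⟨x, rfl⟩; exact (abs_le.1 (hM x)).1⟩
  have hIcc : ∀ z, G z ∈ Set.Icc (⨅ x, G x) ((⨅ x, G x) + c) := fun z =>
    ⟨ciInf_le hbdd z, by
      have : G z - c ≤ ⨅ x, G x := le_ciInf fun x => by
        have := (abs_le.1 (hc z x)).2
        linarith
      linarith⟩
  have h := (hasSubgaussianMGF_of_mem_Icc (μ := ν) hG.aemeasurable
    (Filter.Eventually.of_forall hIcc)).mgf_le 1
  have e : (((‖(⨅ x, G x) + c - ⨅ x, G x‖₊ / 2) ^ 2 : NNReal) : ℝ) * 1 ^ 2 / 2 = c ^ 2 / 8 := by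
    push_cast
    rw [add_sub_cancel_left, Real.norm_eq_abs, div_pow, sq_abs]
    ring
  rw [e] at h
  simpa [mgf] using h

/-- **McDiarmid's inequality** for moment generating functions. -/
theorem integral_exp_sub_integral_pi_le {E : Type*} [MeasurableSpace E] :
    ∀ {n : ℕ} (ν : Fin n → Measure E) [∀ i, IsProbabilityMeasure (ν i)]
    (F : (Fin n → E) → ℝ) (_ : Measurable F) (M : ℝ) (_ : ∀ x, |F x| ≤ M)
    (c : Fin n → ℝ) (_ : ∀ i x z, |F (Function.update x i z) - F x| ≤ c i),
    ∫ x, Real.exp (F x - ∫ y, F y ∂Measure.pi ν) ∂Measure.pi ν ≤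
      Real.exp ((∑ i, c i ^ 2) / 8)
  | 0, ν, _, F, hF, M, hM, c, hc => by
      have : ∀ x, F x = F default := fun x => congrArg F (Subsingleton.elim _ _)
      simp [this]
  | n + 1, ν, _, F, hF, M, hM, c, hc => by
      set ρ := Measure.pi fun i : Fin n => ν i.succ with hρ
      have mp := (measurePreserving_piFinSuccAbove ν 0).symm
      have hcons : Measurable fun p : E × (Fin n → E) => (Fin.cons p.1 p.2 : Fin (n + 1) → E) := by
        have := (MeasurableEquiv.piFinSuccAbove (fun _ : Fin (n + 1) => E) 0).symm.measurable
        convert this using 1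
        ext p i
        simp [MeasurableEquiv.piFinSuccAbove_symm_apply, Fin.insertNthEquiv]
      have hint : ∀ H : (Fin (n + 1) → E) → ℝ, ∫ x, H x ∂Measure.pi ν =
          ∫ p, H (Fin.cons p.1 p.2) ∂((ν 0).prod ρ) := fun H => by
        rw [← mp.integral_comp']
        simp [MeasurableEquiv.piFinSuccAbove_symm_apply, Fin.insertNthEquiv, hρ]
      have hF2 : Measurable fun p : E × (Fin n → E) => F (Fin.cons p.1 p.2) := hF.comp hcons
      have hFint : Integrable (fun p : E × (Fin n → E) => F (Fin.cons p.1 p.2))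
          ((ν 0).prod ρ) :=
        Integrable.of_bound hF2.aestronglyMeasurable M (Filter.Eventually.of_forall fun p => hM _)
      set G : E → ℝ := fun z => ∫ x, F (Fin.cons z x) ∂ρ with hGdef
      have hGm : Measurable G :=
        (StronglyMeasurable.integral_prod_right' (ν := ρ) hF2.stronglyMeasurable).measurable
      have hFz : ∀ z, Integrable (fun x => F (Fin.cons z x)) ρ := fun z =>
        Integrable.of_bound (hF2.comp measurable_prodMk_left).aestronglyMeasurable M
          (Filter.Eventually.of_forall fun p => hM _)
      have hGM : ∀ z, |G z| ≤ M := fun z => by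
        have := norm_integral_le_of_norm_le_const (μ := ρ) (f := fun x => F (Fin.cons z x))
          (Filter.Eventually.of_forall fun x => hM _)
        simpa using this
      have hGc : ∀ z z', |G z - G z'| ≤ c 0 := fun z z' => by
        rw [hGdef]
        simp only
        rw [← integral_sub (hFz z) (hFz z')]
        have := norm_integral_le_of_norm_le_const (μ := ρ)
          (f := fun x => F (Fin.cons z x) - F (Fin.cons z' x)) (C := c 0)
          (Filter.Eventually.of_forall fun x => by
            have := hc 0 (Fin.cons z' x) z
            rwa [Fin.update_cons_zero] at this)
        simpa using this
      have hIF : ∫ y, F y ∂Measure.pi ν = ∫ z, G z ∂ν 0 := by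
        rw [hint, integral_prod _ hFint]
      set a := ∫ z, G z ∂ν 0 with ha
      have hab : |a| ≤ M := by
        have := norm_integral_le_of_norm_le_const (μ := ν 0) (f := G)
          (Filter.Eventually.of_forall fun x => hGM _)
        simpa using this
      -- Write `F - a = (F - G) + (G - a)`, where `G` averages out all coordinates but the first:
      -- induction handles `F - G` for a frozen first coordinate, and Hoeffding's lemma handles `G -
      -- a`.
      rw [hIF, hint, integral_prod]
      · have inner : ∀ z, ∫ x, Real.exp (F (Fin.cons z x) - a) ∂ρ ≤
            Real.exp (G z - a) * Real.exp ((∑ i : Fin n, c i.succ ^ 2) / 8) := fun z => by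
          have ih := integral_exp_sub_integral_pi_le (fun i : Fin n => ν i.succ)
            (fun x => F (Fin.cons z x)) (hF2.comp measurable_prodMk_left) M (fun x => hM _)
            (fun i => c i.succ) (fun i x w => by
              have := hc i.succ (Fin.cons z x) w
              rwa [← Fin.cons_update] at this)
          calc ∫ x, Real.exp (F (Fin.cons z x) - a) ∂ρ
              = ∫ x, Real.exp (G z - a) * Real.exp (F (Fin.cons z x) - G z) ∂ρ := by
                congr 1; ext x; rw [← Real.exp_add]; congr 1; ring
            _ = Real.exp (G z - a) * ∫ x, Real.exp (F (Fin.cons z x) - G z) ∂ρ :=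
                integral_const_mul _ _
            _ ≤ _ := by gcongr
        have hexpG : Integrable (fun z => Real.exp (G z - a)) (ν 0) :=
          Integrable.of_bound (Real.measurable_exp.comp (hGm.sub_const a)).aestronglyMeasurable
            (Real.exp (M + M)) (Filter.Eventually.of_forall fun z => by
              rw [Real.norm_eq_abs, Real.abs_exp, Real.exp_le_exp]
              linarith [(abs_le.1 (hGM z)).2, (abs_le.1 hab).1])
        calc ∫ z, ∫ x, Real.exp (F (Fin.cons z x) - a) ∂ρ ∂ν 0
            ≤ ∫ z, Real.exp (G z - a) * Real.exp ((∑ i : Fin n, c i.succ ^ 2) / 8) ∂ν 0 := by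
              refine integral_mono_of_nonneg
                (Filter.Eventually.of_forall fun z => integral_nonneg fun x => (Real.exp_pos _).le)
                (hexpG.mul_const _) (Filter.Eventually.of_forall inner)
          _ = (∫ z, Real.exp (G z - a) ∂ν 0) * Real.exp ((∑ i : Fin n, c i.succ ^ 2) / 8) :=
              integral_mul_const _ _
          _ ≤ Real.exp (c 0 ^ 2 / 8) * Real.exp ((∑ i : Fin n, c i.succ ^ 2) / 8) := by
              gcongr
              exact integral_exp_sub_integral_le_of_osc (ν 0) G hGm M hGM (c 0) hGc
          _ = _ := by
              rw [← Real.exp_add, Fin.sum_univ_succ]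
              congr 1; ring
      · exact Integrable.of_bound
          (Real.measurable_exp.comp (hF2.sub_const a)).aestronglyMeasurable
            (Real.exp (M + M)) (Filter.Eventually.of_forall fun z => by
              rw [Real.norm_eq_abs, Real.abs_exp, Real.exp_le_exp]
              linarith [(abs_le.1 (hM (Fin.cons z.1 z.2))).2, (abs_le.1 hab).1])

/-- Functions of disjoint blocks of independent coordinates are independent. -/
theorem lintegral_prod_pi_of_dependsOn {ι κ E : Type*} [Fintype ι] [MeasurableSpace E]
    [DecidableEq κ]
    (ν : ι → Measure E) [∀ i, IsProbabilityMeasure (ν i)] (I : κ → Finset ι)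
    (hI : Pairwise fun i j => Disjoint (I i) (I j)) (Φ : κ → (ι → E) → ℝ≥0∞)
    (hΦ : ∀ i, Measurable (Φ i)) (hdep : ∀ i, DependsOn (Φ i) (I i)) (A : Finset κ) :
    ∫⁻ x, ∏ i ∈ A, Φ i x ∂Measure.pi ν = ∏ i ∈ A, ∫⁻ x, Φ i x ∂Measure.pi ν := by
  classical
  rcases isEmpty_or_nonempty ι with hι | hι
  · have : ∀ i x, Φ i x = Φ i default := fun i x => congrArg _ (Subsingleton.elim _ _)
    simp [this]
  have hE : Nonempty E := (ν hι.some).nonempty_of_neZero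
  obtain ⟨e0⟩ := hE
  -- Filling the missing coordinates with an arbitrary `e0` factors a function that depends only on
  -- `S` through the restriction to `S`, the form in which independence of blocks applies.
  let ext (S : Finset ι) (u : S → E) : ι → E := fun i => if h : i ∈ S then u ⟨i, h⟩ else e0
  have hext : ∀ S, Measurable (ext S) := fun S => by
    refine measurable_pi_lambda _ fun i => ?_
    by_cases h : i ∈ S
    · simpa [ext, h] using measurable_pi_apply _
    · simp [ext, h]
  have hfac : ∀ (S : Finset ι) (ψ : (ι → E) → ℝ≥0∞), DependsOn ψ S →
      ψ = fun x => ψ (ext S (fun i : S => x i)) := fun S ψ h => by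
    ext x
    refine h fun i hi => ?_
    have hi' : i ∈ S := hi
    simp [ext, hi']
  induction A using Finset.induction_on with
  | empty => simp
  | insert a A ha ih =>
    simp only [Finset.prod_insert ha]
    rw [← ih]
    have hind : iIndepFun (fun (i : ι) (x : ι → E) => x i) (Measure.pi ν) :=
      iIndepFun_pi (X := fun _ => id) fun i => aemeasurable_id
    have hdisj : Disjoint (I a) (A.biUnion I) := by
      rw [Finset.disjoint_biUnion_right]
      exact fun i hi => hI (by rintro rfl; exact ha hi)
    have h2 := hind.indepFun_finset (I a) (A.biUnion I) hdisj fun i => measurable_pi_apply i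
    have hdepA : DependsOn (fun x => ∏ i ∈ A, Φ i x) (A.biUnion I : Finset ι) := fun x y hxy => by
      refine Finset.prod_congr rfl fun i hi => hdep i fun j hj => hxy j ?_
      exact Finset.mem_coe.2 (Finset.mem_biUnion.2 ⟨i, hi, hj⟩)
    have hmA : Measurable fun x => ∏ i ∈ A, Φ i x :=
      Finset.measurable_prod _ fun i _ => hΦ i
    have h3 := h2.comp (φ := fun u => Φ a (ext _ u))
      (ψ := fun u => ∏ i ∈ A, Φ i (ext (A.biUnion I) u))
      ((hΦ a).comp (hext _)) (hmA.comp (hext _))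
    have e1 : ((fun u => Φ a (ext _ u)) ∘ fun (x : ι → E) (i : I a) => x i) = Φ a :=
      (hfac _ _ (hdep a)).symm
    have e2 : ((fun u => ∏ i ∈ A, Φ i (ext (A.biUnion I) u)) ∘
        fun (x : ι → E) (i : (A.biUnion I : Finset ι)) => x i) = fun x => ∏ i ∈ A, Φ i x :=
      (hfac _ _ hdepA).symm
    rw [e1, e2] at h3
    exact lintegral_mul_eq_lintegral_mul_lintegral_of_indepFun (hΦ a) hmA h3

/-! ### Discrepancy over Lipschitz functions. -/

/-- The `1`-Lipschitz functions with values in `[0, d]`. -/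
def lipClass (E : Type*) [MetricSpace E] (d : ℝ) : Set (E → ℝ) :=
  {h | LipschitzWith 1 h ∧ ∀ z, h z ∈ Set.Icc 0 d}

theorem zero_mem_lipClass {E : Type*} [MetricSpace E] {d : ℝ} (hd : 0 ≤ d) :
    (fun _ => 0 : E → ℝ) ∈ lipClass E d :=
  ⟨LipschitzWith.const' 0, fun _ => ⟨le_rfl, hd⟩⟩

section Discrepancy

variable {E ι : Type*} [MetricSpace E] [MeasurableSpace E] [BorelSpace E]

/-- The number of sample points in `I` times the Wasserstein distance between `ν` and the empirical
measure of the sample points in `I`. -/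
noncomputable def lipDisc (ν : Measure E) (d : ℝ) (I : Finset ι) (D : ι → E) : ℝ :=
  ⨆ h : lipClass E d, ∑ n ∈ I, (∫ z, h.1 z ∂ν - h.1 (D n))

theorem integrable_of_mem_lipClass {ν : Measure E} [IsProbabilityMeasure ν] {d : ℝ} {h : E → ℝ}
    (hh : h ∈ lipClass E d) : Integrable h ν :=
  Integrable.of_mem_Icc 0 d hh.1.continuous.measurable.aemeasurable
    (Filter.Eventually.of_forall hh.2)

theorem integral_mem_of_mem_lipClass {ν : Measure E} [IsProbabilityMeasure ν] {d : ℝ} {h : E → ℝ}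
    (hh : h ∈ lipClass E d) : ∫ z, h z ∂ν ∈ Set.Icc 0 d := by
  refine ⟨integral_nonneg fun z => (hh.2 z).1, ?_⟩
  calc ∫ z, h z ∂ν ≤ ∫ _, d ∂ν :=
        integral_mono (integrable_of_mem_lipClass hh) (integrable_const _) fun z => (hh.2 z).2
    _ = d := by simp

variable {ν : Measure E} [IsProbabilityMeasure ν] {d : ℝ}

theorem sum_le_of_mem_lipClass (I : Finset ι) (D : ι → E) {h : E → ℝ} (hh : h ∈ lipClass E d) :
    ∑ n ∈ I, (∫ z, h z ∂ν - h (D n)) ≤ d * I.card := by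
  calc ∑ n ∈ I, (∫ z, h z ∂ν - h (D n)) ≤ ∑ n ∈ I, d := by
        refine Finset.sum_le_sum fun n _ => ?_
        linarith [(integral_mem_of_mem_lipClass (ν := ν) hh).2, (hh.2 (D n)).1]
    _ = d * I.card := by simp [mul_comm]

theorem le_lipDisc (I : Finset ι) (D : ι → E) {h : E → ℝ} (hh : h ∈ lipClass E d) :
    ∑ n ∈ I, (∫ z, h z ∂ν - h (D n)) ≤ lipDisc ν d I D :=
  le_ciSup (f := fun h : lipClass E d => ∑ n ∈ I, (∫ z, h.1 z ∂ν - h.1 (D n)))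
    ⟨d * I.card, by rintro _ ⟨h, rfl⟩; exact sum_le_of_mem_lipClass I D h.2⟩ ⟨h, hh⟩

theorem lipDisc_le_of_forall (hd : 0 ≤ d) {I : Finset ι} {D : ι → E} {b : ℝ}
    (hb : ∀ h ∈ lipClass E d, ∑ n ∈ I, (∫ z, h z ∂ν - h (D n)) ≤ b) : lipDisc ν d I D ≤ b :=
  haveI : Nonempty (lipClass E d) := ⟨⟨_, zero_mem_lipClass hd⟩⟩
  ciSup_le fun h => hb h.1 h.2

theorem lipDisc_nonneg (hd : 0 ≤ d) (I : Finset ι) (D : ι → E) : 0 ≤ lipDisc ν d I D := by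
  simpa using le_lipDisc (ν := ν) I D (zero_mem_lipClass hd)

theorem lipDisc_le (hd : 0 ≤ d) (I : Finset ι) (D : ι → E) : lipDisc ν d I D ≤ d * I.card :=
  lipDisc_le_of_forall hd fun _ hh => sum_le_of_mem_lipClass I D hh

theorem lipDisc_le_add (hd : 0 ≤ d) {I : Finset ι} {D D' : ι → E} {b : ι → ℝ}
    (hb : ∀ n ∈ I, ∀ h ∈ lipClass E d, h (D' n) - h (D n) ≤ b n) :
    lipDisc ν d I D ≤ lipDisc ν d I D' + ∑ n ∈ I, b n :=
  lipDisc_le_of_forall hd fun h hh => by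
    calc ∑ n ∈ I, (∫ z, h z ∂ν - h (D n))
        ≤ ∑ n ∈ I, ((∫ z, h z ∂ν - h (D' n)) + b n) :=
          Finset.sum_le_sum fun n hn => by linarith [hb n hn h hh]
      _ = ∑ n ∈ I, (∫ z, h z ∂ν - h (D' n)) + ∑ n ∈ I, b n := Finset.sum_add_distrib
      _ ≤ _ := by gcongr; exact le_lipDisc I D' hh

theorem dependsOn_lipDisc (I : Finset ι) : DependsOn (lipDisc ν d I) (I : Set ι) := by
  intro D D' h
  unfold lipDisc
  congr 1
  ext g
  exact Finset.sum_congr rfl fun n hn => by rw [h n hn]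

/-- The supremum runs over an uncountable class, but it is Lipschitz in the sample, with constant
`I.card`, hence continuous. -/
theorem measurable_lipDisc [SecondCountableTopology E] [Fintype ι] (hd : 0 ≤ d) (I : Finset ι) :
    Measurable (lipDisc ν d I : (ι → E) → ℝ) := by
  refine Continuous.measurable (LipschitzWith.continuous (K := I.card) ?_)
  refine LipschitzWith.of_le_add_mul _ fun D D' => ?_
  have := lipDisc_le_add (ν := ν) hd (I := I) (D := D) (D' := D') (b := fun _ => dist D D')
    fun n _ h hh => by
      have h1 := hh.1.dist_le_mul (D n) (D' n)
      rw [NNReal.coe_one, one_mul, dist_comm, Real.dist_eq] at h1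
      exact (le_abs_self _).trans (h1.trans (dist_le_pi_dist D D' n))
  simpa using this

/-- The bounded differences for McDiarmid: a test function takes values in `[0, d]`, and points
outside `I` do not enter. -/
theorem abs_lipDisc_update_sub_le [DecidableEq ι] (hd : 0 ≤ d) (I : Finset ι) (D : ι → E) (i : ι)
    (z : E) :
    |lipDisc ν d I (Function.update D i z) - lipDisc ν d I D| ≤ if i ∈ I then d else 0 := by
  have key : ∀ D D' : ι → E, (∀ n, n ≠ i → D n = D' n) →
      lipDisc ν d I D ≤ lipDisc ν d I D' + if i ∈ I then d else 0 := fun D D' h => by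
    have := lipDisc_le_add (ν := ν) hd (I := I) (D := D) (D' := D')
      (b := fun n => if n = i then d else 0) fun n _ g hg => by
        by_cases hn : n = i
        · simp only [hn, if_true]
          linarith [(hg.2 (D' i)).2, (hg.2 (D i)).1]
        · simp [hn, h n hn]
    simpa using this
  rw [abs_sub_le_iff]
  constructor
  · linarith [key (Function.update D i z) D fun n hn => Function.update_of_ne hn _ _]
  · linarith [key D (Function.update D i z) fun n hn => (Function.update_of_ne hn _ _).symm]

end Discrepancy

/-! ### Chaining bound for the expected discrepancy. -/

theorem integral_abs_le_sqrt {Ω : Type*} [MeasurableSpace Ω] {P : Measure Ω}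
    [IsProbabilityMeasure P] {Z : Ω → ℝ} (hZ : MemLp Z 2 P) :
    ∫ ω, |Z ω| ∂P ≤ √(∫ ω, Z ω ^ 2 ∂P) := by
  refine Real.le_sqrt_of_sq_le ?_
  have h := variance_nonneg |Z| P
  rw [variance_eq_sub hZ.abs] at h
  simpa using h

/-- The number of hits of `A` is a sum of independent indicators, so its variance is at most its
mean `I.card * ν(A)`. -/
theorem integral_abs_sum_indicator_le {E ι : Type*} [MeasurableSpace E] [Fintype ι]
    (ν : Measure E) [IsProbabilityMeasure ν] (I : Finset ι)
    (ρ : ι → Measure E) [∀ i, IsProbabilityMeasure (ρ i)] (hρ : ∀ i ∈ I, ρ i = ν)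
    {A : Set E} (hA : MeasurableSet A) :
    ∫ D, |∑ n ∈ I, (ν.real A - A.indicator 1 (D n))| ∂Measure.pi ρ ≤ √(I.card * ν.real A) := by
  have hX : ∀ n, MemLp (fun D : ι → E => A.indicator (1 : E → ℝ) (D n)) 2 (Measure.pi ρ) :=
    fun n => MemLp.of_bound (((measurable_one.indicator hA).comp
      (measurable_pi_apply n)).aestronglyMeasurable) 1 (Filter.Eventually.of_forall fun D => by
        by_cases h : D n ∈ A <;> simp [h])
  have hmean : ∀ n ∈ I, ∫ D : ι → E, A.indicator (1 : E → ℝ) (D n) ∂Measure.pi ρ = ν.real A :=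
    fun n hn => by
      rw [integral_comp_eval (X := fun _ => E) (μ := ρ) (i := n) (f := A.indicator (1 : E → ℝ))
        ((measurable_one.indicator hA).aestronglyMeasurable), hρ n hn, integral_indicator_one hA]
  set Y : (ι → E) → ℝ := fun D => ∑ n ∈ I, A.indicator (1 : E → ℝ) (D n) with hY
  have hYL : MemLp Y 2 (Measure.pi ρ) := memLp_finsetSum _ fun n _ => hX n
  have hYm : ∫ D, Y D ∂Measure.pi ρ = I.card * ν.real A := by
    rw [hY, integral_finsetSum _ fun n _ => (hX n).integrable one_le_two,
      Finset.sum_congr rfl hmean]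
    simp
  have hvar : Var[Y; Measure.pi ρ] ≤ I.card * ν.real A := by
    have e : Y = ∑ n ∈ I, fun D : ι → E => A.indicator (1 : E → ℝ) (D n) := by
      ext D; simp [hY]
    have hind : iIndepFun (fun (i : ι) (x : ι → E) => A.indicator (1 : E → ℝ) (x i))
        (Measure.pi ρ) :=
      iIndepFun_pi (X := fun _ => A.indicator (1 : E → ℝ))
        fun i => (measurable_one.indicator hA).aemeasurable
    rw [e, IndepFun.variance_sum (fun n _ => hX n) fun i _ j _ hij => hind.indepFun hij]
    calc ∑ n ∈ I, Var[fun D : ι → E => A.indicator (1 : E → ℝ) (D n); Measure.pi ρ]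
        ≤ ∑ n ∈ I, ν.real A := by
          refine Finset.sum_le_sum fun n hn => ?_
          refine (variance_le_expectation_sq (hX n).aestronglyMeasurable).trans ?_
          rw [← hmean n hn]
          refine le_of_eq (integral_congr_ae (Filter.Eventually.of_forall fun D => ?_))
          by_cases h : D n ∈ A <;> simp [h]
      _ = _ := by simp
  have e1 : ∀ D : ι → E, ∑ n ∈ I, (ν.real A - A.indicator 1 (D n)) =
      I.card * ν.real A - Y D := fun D => by
    simp [hY, Finset.sum_sub_distrib]
  simp_rw [e1]
  refine (integral_abs_le_sqrt ((memLp_const _).sub hYL)).trans (Real.sqrt_le_sqrt ?_)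
  refine le_trans (le_of_eq ?_) hvar
  rw [variance_eq_integral hYL.aemeasurable, hYm]
  congr 1
  ext D
  simp only [Pi.sub_apply]
  ring

theorem exists_measurable_nearest {E : Type*} [MetricSpace E] [MeasurableSpace E] [BorelSpace E]
    [SecondCountableTopology E] (T : Finset E) (hT : T.Nonempty) :
    ∃ π : E → E, Measurable π ∧ (∀ z, π z ∈ T) ∧ ∀ z, ∀ y ∈ T, dist z (π z) ≤ dist z y := by
  classical
  induction hT using Finset.Nonempty.cons_induction with
  | singleton a => exact ⟨fun _ => a, measurable_const, by simp, by simp⟩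
  | cons a T ha hT ih =>
    obtain ⟨π, hπ, hmem, hle⟩ := ih
    refine ⟨fun z => if dist z a ≤ dist z (π z) then a else π z,
      Measurable.ite (measurableSet_le (measurable_id.dist measurable_const)
        (measurable_id.dist hπ)) measurable_const hπ, fun z => ?_, fun z y hy => ?_⟩
    · simp only [Finset.mem_cons]
      split_ifs
      · exact Or.inl rfl
      · exact Or.inr (hmem z)
    · dsimp only
      rcases Finset.mem_cons.1 hy with rfl | hy
      · split_ifs with h
        · exact le_rfl
        · exact (not_le.1 h).le
      · split_ifs with h
        · exact h.trans (hle z y hy)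
        · exact hle z y hy

section Chaining

variable {E ι : Type*} [MetricSpace E] [MeasurableSpace E] [BorelSpace E]
  [SecondCountableTopology E] [Fintype ι]

/-- Cauchy–Schwarz over the fibres of `g`, whose masses add up to at most `1`. -/
theorem integral_sum_abs_fiber_le (ν : Measure E) [IsProbabilityMeasure ν] (I : Finset ι)
    (ρ : ι → Measure E) [∀ i, IsProbabilityMeasure (ρ i)] (hρ : ∀ i ∈ I, ρ i = ν)
    (T : Finset E) (g : E → E) (hg : Measurable g) :
    ∫ D, ∑ q ∈ T, |∑ n ∈ I, (ν.real (g ⁻¹' {q}) - (g ⁻¹' {q}).indicator 1 (D n))| ∂Measure.pi ρ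
      ≤ √(I.card * T.card) := by
  have hA : ∀ q, MeasurableSet (g ⁻¹' {q}) := fun q => hg (measurableSet_singleton q)
  have hint : ∀ q ∈ T, Integrable (fun D : ι → E =>
      |∑ n ∈ I, (ν.real (g ⁻¹' {q}) - (g ⁻¹' {q}).indicator 1 (D n))|) (Measure.pi ρ) :=
    fun q _ => (integrable_finsetSum _ fun n _ => (integrable_const _).sub
      (Integrable.of_bound (((measurable_one.indicator (hA q)).comp
        (measurable_pi_apply n)).aestronglyMeasurable) 1 (Filter.Eventually.of_forall fun D => by
          by_cases h : D n ∈ g ⁻¹' {q} <;> simp_all))).abs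
  rw [integral_finsetSum _ hint]
  calc ∑ q ∈ T, ∫ D, |∑ n ∈ I, (ν.real (g ⁻¹' {q}) - (g ⁻¹' {q}).indicator 1 (D n))|
        ∂Measure.pi ρ
      ≤ ∑ q ∈ T, √(I.card * ν.real (g ⁻¹' {q})) :=
        Finset.sum_le_sum fun q _ => integral_abs_sum_indicator_le ν I ρ hρ (hA q)
    _ = ∑ q ∈ T, √(I.card * ν.real (g ⁻¹' {q})) * √1 := by simp
    _ ≤ √(∑ q ∈ T, I.card * ν.real (g ⁻¹' {q})) * √(∑ q ∈ T, 1) :=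
        Real.sum_sqrt_mul_sqrt_le T (fun q => by positivity) (fun _ => zero_le_one)
    _ ≤ √I.card * √T.card := by
        gcongr
        · rw [← Finset.mul_sum, sum_measureReal_preimage_singleton _ fun q _ => hA q]
          exact mul_le_of_le_one_right (by positivity) measureReal_le_one
        · simp
    _ = _ := (Real.sqrt_mul (by positivity) _).symm

/-- The chain descends from the net `T j` to the one-point net `T 0`, where the sum vanishes. Each
link costs the net spacing times the deviations of the fibre frequencies, a quantity free of the
test function. An integrable majorant `G` replaces the supremum, so no measurability of intermediate
suprema is needed. -/
theorem exists_chaining_bound {ν : Measure E} [IsProbabilityMeasure ν] (I : Finset ι)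
    (ρ : ι → Measure E) [∀ i, IsProbabilityMeasure (ρ i)] (hρ : ∀ i ∈ I, ρ i = ν)
    {d : ℝ} (hd : 0 ≤ d) {S : Set E} {T : ℕ → Finset E} (hTS : ∀ j, ↑(T j) ⊆ S)
    (hTne : ∀ j, (T j).Nonempty)
    (hT0 : (T 0).card = 1) (hT : ∀ j, ∀ x ∈ S, ∃ y ∈ T j, dist x y ≤ d / 2 ^ j) :
    ∀ (j : ℕ) (g : E → E), Measurable g → (∀ z, g z ∈ T j) →
      ∃ G : (ι → E) → ℝ, Integrable G (Measure.pi ρ) ∧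
        ∫ D, G D ∂Measure.pi ρ ≤
          ∑ i ∈ Finset.range j, d / 2 ^ i * √(I.card * (T (i + 1)).card) ∧
        ∀ (D : ι → E), ∀ h ∈ lipClass E d, ∑ n ∈ I, (∫ z, h (g z) ∂ν - h (g (D n))) ≤ G D := by
  intro j
  induction j with
  | zero =>
    intro g _ hgT
    obtain ⟨p, hp⟩ := Finset.card_eq_one.1 hT0
    have hgp : ∀ z, g z = p := fun z => by simpa [hp] using hgT z
    exact ⟨0, integrable_zero _ _ _, by simp, fun D h _ => by simp [hgp]⟩
  | succ j ih =>
    intro g hg hgT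
    obtain ⟨π, hπ, hπT, hπle⟩ := exists_measurable_nearest (T j) (hTne j)
    -- The coarse point is the nearest point to `g z`, not to `z`. The link `h (g z) - h (π (g z))`
    -- is therefore constant on the fibres of `g`.
    obtain ⟨G, hGi, hGle, hG⟩ := ih (π ∘ g) (hπ.comp hg) fun z => hπT _
    have hA : ∀ q, MeasurableSet (g ⁻¹' {q}) := fun q => hg (measurableSet_singleton q)
    have hind : ∀ q, Integrable ((g ⁻¹' {q}).indicator (1 : E → ℝ)) ν := fun q =>
      (integrable_const (1 : ℝ)).indicator (hA q)
    set V : (ι → E) → ℝ := fun D => ∑ q ∈ T (j + 1),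
      |∑ n ∈ I, (ν.real (g ⁻¹' {q}) - (g ⁻¹' {q}).indicator 1 (D n))| with hV
    have hVi : Integrable V (Measure.pi ρ) :=
      integrable_finsetSum _ fun q _ =>
        (integrable_finsetSum _ fun n _ => (integrable_const _).sub
          (Integrable.of_bound (((measurable_one.indicator (hA q)).comp
            (measurable_pi_apply n)).aestronglyMeasurable) 1
              (Filter.Eventually.of_forall fun D => by
                by_cases h : D n ∈ g ⁻¹' {q} <;> simp_all))).abs
    refine ⟨fun D => G D + d / 2 ^ j * V D, hGi.add (hVi.const_mul _), ?_, fun D h hh => ?_⟩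
    · rw [integral_add hGi (hVi.const_mul _), integral_const_mul, Finset.sum_range_succ]
      gcongr
      exact integral_sum_abs_fiber_le ν I ρ hρ (T (j + 1)) g hg
    · set w : E → ℝ := fun q => h q - h (π q) with hw
      -- Here the nets must lie in `S`: the coarse net is only known to cover points of `S`.
      have hwle : ∀ q ∈ T (j + 1), |w q| ≤ d / 2 ^ j := fun q hq => by
        obtain ⟨y, hy, hqy⟩ := hT j q (hTS _ hq)
        have := hh.1.dist_le_mul q (π q)
        rw [NNReal.coe_one, one_mul, Real.dist_eq] at this
        exact this.trans ((hπle q y hy).trans hqy)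
      have hsplit : ∀ z, h (g z) = h (π (g z)) +
          ∑ q ∈ T (j + 1), w q * (g ⁻¹' {q}).indicator 1 z := fun z => by
        rw [Finset.sum_eq_single_of_mem (g z) (hgT z)]
        · simp [hw]
        · intro q _ hq
          rw [Set.indicator_of_notMem, mul_zero]
          exact fun hz => hq (by simpa using Eq.symm hz)
      have hmean : ∫ z, h (g z) ∂ν = ∫ z, h (π (g z)) ∂ν +
          ∑ q ∈ T (j + 1), w q * ν.real (g ⁻¹' {q}) := by
        simp_rw [hsplit]
        rw [integral_add, integral_finsetSum]
        · congr 1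
          refine Finset.sum_congr rfl fun q _ => ?_
          rw [integral_const_mul, integral_indicator_one (hA q)]
        · exact fun q _ => (hind q).const_mul _
        · exact Integrable.of_mem_Icc 0 d
            (hh.1.continuous.measurable.comp (hπ.comp hg)).aemeasurable
            (Filter.Eventually.of_forall fun z => hh.2 _)
        · exact integrable_finsetSum _ fun q _ => (hind q).const_mul _
      calc ∑ n ∈ I, (∫ z, h (g z) ∂ν - h (g (D n)))
          = ∑ n ∈ I, ((∫ z, h (π (g z)) ∂ν - h (π (g (D n)))) +
              ∑ q ∈ T (j + 1), w q * (ν.real (g ⁻¹' {q}) - (g ⁻¹' {q}).indicator 1 (D n))) := by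
            refine Finset.sum_congr rfl fun n _ => ?_
            rw [hmean, hsplit (D n)]
            simp only [mul_sub, Finset.sum_sub_distrib]
            ring
        _ = ∑ n ∈ I, (∫ z, h (π (g z)) ∂ν - h (π (g (D n)))) +
              ∑ q ∈ T (j + 1), w q *
                ∑ n ∈ I, (ν.real (g ⁻¹' {q}) - (g ⁻¹' {q}).indicator 1 (D n)) := by
            rw [Finset.sum_add_distrib, Finset.sum_comm]
            simp only [Finset.mul_sum]
        _ ≤ G D + d / 2 ^ j * V D := by
            refine add_le_add (hG D h hh) ?_
            rw [hV, Finset.mul_sum]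
            refine Finset.sum_le_sum fun q hq => (le_abs_self _).trans ?_
            rw [abs_mul]
            gcongr
            exact hwle q hq

/-- The chain stops at level `J`. Replacing `z` by its nearest point of `T J` costs `d / 2 ^ J` in
the mean and again at each sample point, which is the last summand. -/
theorem integral_lipDisc_le_chaining {ν : Measure E} [IsProbabilityMeasure ν] (I : Finset ι)
    (ρ : ι → Measure E) [∀ i, IsProbabilityMeasure (ρ i)] (hρ : ∀ i ∈ I, ρ i = ν)
    {d : ℝ} (hd : 0 ≤ d) {S : Set E} {T : ℕ → Finset E} (hTS : ∀ j, ↑(T j) ⊆ S)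
    (hTne : ∀ j, (T j).Nonempty)
    (hT0 : (T 0).card = 1) (hT : ∀ j, ∀ x ∈ S, ∃ y ∈ T j, dist x y ≤ d / 2 ^ j)
    (hS : ∀ᵐ z ∂ν, z ∈ S) (J : ℕ) :
    ∫ D, lipDisc ν d I D ∂Measure.pi ρ ≤
      ∑ i ∈ Finset.range J, d / 2 ^ i * √(I.card * (T (i + 1)).card) +
        I.card * (2 * (d / 2 ^ J)) := by
  obtain ⟨π, hπ, hπT, hπle⟩ := exists_measurable_nearest (T J) (hTne J)
  obtain ⟨G, hGi, hGle, hG⟩ := exists_chaining_bound I ρ hρ hd hTS hTne hT0 hT J π hπ hπT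
  have hclose : ∀ h ∈ lipClass E d, ∀ z ∈ S, |h z - h (π z)| ≤ d / 2 ^ J := fun h hh z hz => by
    obtain ⟨y, hy, hzy⟩ := hT J z hz
    have := hh.1.dist_le_mul z (π z)
    rw [NNReal.coe_one, one_mul, Real.dist_eq] at this
    exact this.trans ((hπle z y hy).trans hzy)
  have hae : ∀ᵐ D ∂Measure.pi ρ, ∀ n ∈ I, D n ∈ S := by
    refine (Finset.eventually_all I).2 fun n hn => ?_
    have : ∀ᵐ z ∂ρ n, z ∈ S := by rw [hρ n hn]; exact hS
    exact (measurePreserving_eval ρ n).quasiMeasurePreserving.ae this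
  have hle : ∀ᵐ D ∂Measure.pi ρ, lipDisc ν d I D ≤ G D + I.card * (2 * (d / 2 ^ J)) := by
    filter_upwards [hae] with D hD
    refine lipDisc_le_of_forall hd fun h hh => ?_
    have hi1 : Integrable (fun z => h (π z)) ν := Integrable.of_mem_Icc 0 d
      (hh.1.continuous.measurable.comp hπ).aemeasurable
      (Filter.Eventually.of_forall fun z => hh.2 _)
    have hm : ∫ z, h z ∂ν ≤ ∫ z, h (π z) ∂ν + d / 2 ^ J := by
      calc ∫ z, h z ∂ν ≤ ∫ z, (h (π z) + d / 2 ^ J) ∂ν := by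
            refine integral_mono_ae (integrable_of_mem_lipClass hh)
              (hi1.add (integrable_const _)) ?_
            filter_upwards [hS] with z hz
            linarith [(abs_le.1 (hclose h hh z hz)).2]
        _ = _ := by rw [integral_add hi1 (integrable_const _)]; simp
    calc ∑ n ∈ I, (∫ z, h z ∂ν - h (D n))
        ≤ ∑ n ∈ I, ((∫ z, h (π z) ∂ν - h (π (D n))) + 2 * (d / 2 ^ J)) :=
          Finset.sum_le_sum fun n hn => by
            linarith [(abs_le.1 (hclose h hh _ (hD n hn))).1]
      _ = ∑ n ∈ I, (∫ z, h (π z) ∂ν - h (π (D n))) + I.card * (2 * (d / 2 ^ J)) := by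
          rw [Finset.sum_add_distrib]; simp
      _ ≤ _ := by gcongr; exact hG D h hh
  have hli : Integrable (lipDisc ν d I) (Measure.pi ρ) :=
    Integrable.of_mem_Icc 0 (d * I.card) (measurable_lipDisc hd I).aemeasurable
      (Filter.Eventually.of_forall fun D => ⟨lipDisc_nonneg hd I D, lipDisc_le hd I D⟩)
  calc ∫ D, lipDisc ν d I D ∂Measure.pi ρ
      ≤ ∫ D, (G D + I.card * (2 * (d / 2 ^ J))) ∂Measure.pi ρ :=
        integral_mono_ae hli (hGi.add (integrable_const _)) hle
    _ = ∫ D, G D ∂Measure.pi ρ + I.card * (2 * (d / 2 ^ J)) := by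
        rw [integral_add hGi (integrable_const _)]; simp
    _ ≤ _ := by gcongr

/-- The terms grow geometrically with ratio `√(2^m) / 2 ≥ √8 / 2 ≥ 7/5`, so the sum is controlled by
the next term. The factor `5/2` is `1 / (7/5 - 1)`. -/
theorem sum_sqrt_two_pow_div_le {m : ℕ} (hm : 3 ≤ m) (J : ℕ) :
    ∑ i ∈ Finset.range J, √((2 : ℝ) ^ (i * m)) / 2 ^ i ≤ 5 / 2 * (√((2 : ℝ) ^ (J * m)) / 2 ^ J) := by
  induction J with
  | zero => norm_num
  | succ J ih =>
    rw [Finset.sum_range_succ]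
    have h8 : (14 / 5 : ℝ) ≤ √(2 ^ m) := by
      refine Real.le_sqrt_of_sq_le ?_
      calc ((14 / 5 : ℝ)) ^ 2 ≤ 2 ^ 3 := by norm_num
        _ ≤ 2 ^ m := pow_le_pow_right₀ (by norm_num) hm
    have e : √((2 : ℝ) ^ ((J + 1) * m)) / 2 ^ (J + 1) =
        (√((2 : ℝ) ^ (J * m)) / 2 ^ J) * (√(2 ^ m) / 2) := by
      rw [add_mul, one_mul, pow_add, Real.sqrt_mul (by positivity), pow_succ]
      field_simp
    rw [e]
    have hb : 0 ≤ √((2 : ℝ) ^ (J * m)) / 2 ^ J := by positivity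
    nlinarith

theorem integral_lipDisc_le {m : ℕ} (hm : 3 ≤ m) {K : ℝ}
    {ν : Measure E} [IsProbabilityMeasure ν] (I : Finset ι)
    (ρ : ι → Measure E) [∀ i, IsProbabilityMeasure (ρ i)] (hρ : ∀ i ∈ I, ρ i = ν)
    {d : ℝ} (hd : 0 ≤ d) {S : Set E} (hSd : ∀ x ∈ S, ∀ y ∈ S, dist x y ≤ d)
    (hT : ∀ j : ℕ, ∃ T : Finset E, ↑T ⊆ S ∧ (T.card : ℝ) ≤ K * 2 ^ (j * m) ∧
      ∀ x ∈ S, ∃ y ∈ T, dist x y ≤ d / 2 ^ j)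
    (hS : ∀ᵐ z ∂ν, z ∈ S) :
    ∫ D, lipDisc ν d I D ∂Measure.pi ρ ≤
      (4 + 5 * √(K * 2 ^ m)) * d * (I.card : ℝ) ^ (1 - 1 / (m : ℝ)) := by
  rcases Nat.eq_zero_or_pos I.card with hI | hI
  · have hz : ∀ D, lipDisc ν d I D = 0 := fun D => le_antisymm
      (by simpa [hI] using lipDisc_le (ν := ν) hd I D) (lipDisc_nonneg hd I D)
    simp only [hz, integral_zero]
    positivity
  have hm0 : 0 < m := by omega
  obtain ⟨p, hp⟩ : ∃ p, p ∈ S := hS.exists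
  choose T0 hT0S hT0c hT0 using hT
  -- One point is already a `d`-net of a set of diameter at most `d`; the chain has to end in a
  -- singleton.
  set T : ℕ → Finset E := fun j => if j = 0 then {p} else T0 j with hTdef
  have hTs : ∀ j, T (j + 1) = T0 (j + 1) := fun j => by simp [hTdef]
  have hTS : ∀ j, ↑(T j) ⊆ S := fun j => by
    rcases j with _ | j
    · simpa [hTdef] using hp
    · rw [hTs]; exact hT0S _
  have hTc : ∀ j, ∀ x ∈ S, ∃ y ∈ T j, dist x y ≤ d / 2 ^ j := fun j x hx => by
    rcases j with _ | j
    · exact ⟨p, by simp [hTdef], by simpa using hSd x hx p hp⟩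
    · rw [hTs]; exact hT0 _ x hx
  -- The balancing level, `2^(J m) ≤ n < 2^((J+1) m)`: the chaining sum and the truncation error are
  -- then both of order `d n / 2^J`, that is `d n^(1 - 1/m)`.
  set J := Nat.log (2 ^ m) I.card with hJ
  have h1 := integral_lipDisc_le_chaining I ρ hρ hd hTS
    (fun j => let ⟨y, hy, _⟩ := hTc j p hp; ⟨y, hy⟩) (by simp [hTdef]) hTc hS J
  set n : ℝ := ((I.card : ℕ) : ℝ) with hn
  have hn1 : (1 : ℝ) ≤ n := by rw [hn]; exact_mod_cast hI
  have hJle : (2 : ℝ) ^ (J * m) ≤ n := by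
    have := Nat.pow_log_le_self (2 ^ m) hI.ne'
    rw [← pow_mul, mul_comm] at this
    rw [hn, hJ]
    exact_mod_cast this
  have hJlt : n ≤ (2 * 2 ^ J : ℝ) ^ m := by
    have := (Nat.lt_pow_succ_log_self (b := 2 ^ m) (Nat.one_lt_two_pow hm0.ne') I.card).le
    rw [← pow_mul, mul_comm, pow_mul, Nat.succ_eq_add_one, pow_succ, mul_comm] at this
    rw [hn, hJ]
    exact_mod_cast this
  have hroot : n ^ (1 / (m : ℝ)) ≤ 2 * 2 ^ J := by
    calc n ^ (1 / (m : ℝ)) ≤ ((2 * 2 ^ J : ℝ) ^ m) ^ (1 / (m : ℝ)) := by gcongr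
      _ = 2 * 2 ^ J := by
        rw [one_div, Real.pow_rpow_inv_natCast (by positivity) hm0.ne']
  have hpow : n / 2 ^ J ≤ 2 * n ^ (1 - 1 / (m : ℝ)) := by
    rw [Real.rpow_sub (by linarith), Real.rpow_one, ← mul_div_assoc,
      div_le_div_iff₀ (by positivity) (by positivity)]
    nlinarith
  have hsum : ∑ i ∈ Finset.range J, d / 2 ^ i * √(n * (T (i + 1)).card) ≤
      5 / 2 * √(K * 2 ^ m) * d * (n / 2 ^ J) := by
    have hKm : 0 ≤ K * 2 ^ m := by
      have := (Nat.cast_nonneg _).trans (hT0c 1)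
      simpa using this
    calc ∑ i ∈ Finset.range J, d / 2 ^ i * √(n * (T (i + 1)).card)
        ≤ ∑ i ∈ Finset.range J,
            d * √n * √(K * 2 ^ m) * (√((2 : ℝ) ^ (i * m)) / 2 ^ i) := by
          refine Finset.sum_le_sum fun i _ => ?_
          have : √(n * (T (i + 1)).card) ≤ √n * (√(K * 2 ^ m) * √((2 : ℝ) ^ (i * m))) := by
            rw [← Real.sqrt_mul hKm, ← Real.sqrt_mul (by positivity)]
            refine Real.sqrt_le_sqrt ?_
            gcongr
            rw [hTs]
            refine (hT0c (i + 1)).trans (le_of_eq ?_)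
            rw [add_mul, one_mul, pow_add]; ring
          calc d / 2 ^ i * √(n * (T (i + 1)).card)
              ≤ d / 2 ^ i * (√n * (√(K * 2 ^ m) * √((2 : ℝ) ^ (i * m)))) := by gcongr
            _ = _ := by ring
      _ = d * √n * √(K * 2 ^ m) * ∑ i ∈ Finset.range J, √((2 : ℝ) ^ (i * m)) / 2 ^ i := by
          rw [Finset.mul_sum]
      _ ≤ d * √n * √(K * 2 ^ m) * (5 / 2 * (√n / 2 ^ J)) := by
          refine mul_le_mul_of_nonneg_left ((sum_sqrt_two_pow_div_le hm J).trans ?_)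
            (by positivity)
          gcongr
      _ = 5 / 2 * √(K * 2 ^ m) * d * (√n * √n / 2 ^ J) := by ring
      _ = _ := by rw [Real.mul_self_sqrt (by linarith)]
  calc ∫ D, lipDisc ν d I D ∂Measure.pi ρ
      ≤ 5 / 2 * √(K * 2 ^ m) * d * (n / 2 ^ J) + n * (2 * (d / 2 ^ J)) :=
        h1.trans (by gcongr)
    _ = (2 + 5 / 2 * √(K * 2 ^ m)) * d * (n / 2 ^ J) := by ring
    _ ≤ (2 + 5 / 2 * √(K * 2 ^ m)) * d * (2 * n ^ (1 - 1 / (m : ℝ))) := by gcongr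
    _ = _ := by ring

end Chaining

/-! ### Nets in immersed manifolds. -/

theorem exists_finset_net_of_biLipschitz {X : Type*} [MetricSpace X] {m : ℕ} {S : Set X}
    {v : X → Fin m → ℝ} {K : ℕ} (hK : 0 < K)
    (hv : ∀ x ∈ S, ∀ y ∈ S, dist (v x) (v y) ≤ K * dist x y)
    (hv' : ∀ x ∈ S, ∀ y ∈ S, dist x y ≤ K * dist (v x) (v y))
    {d : ℝ} (hd : 0 ≤ d) (hS : ∀ x ∈ S, ∀ y ∈ S, dist x y ≤ d) (j : ℕ) :
    ∃ T : Finset X, ↑T ⊆ S ∧ T.card ≤ (2 * K ^ 2 + 1) ^ m * 2 ^ (j * m) ∧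
      ∀ x ∈ S, ∃ y ∈ T, dist x y ≤ d / 2 ^ j := by
  classical
  rcases S.eq_empty_or_nonempty with rfl | ⟨p, hp⟩
  · exact ⟨∅, by simp, by simp, by simp⟩
  rcases hd.eq_or_lt with rfl | hd
  · refine ⟨{p}, by simpa using hp, ?_, fun x hx => ⟨p, by simp, ?_⟩⟩
    · rw [Finset.card_singleton]
      exact Nat.one_le_iff_ne_zero.2 (by positivity)
    · simpa using hS x hx p hp
  have hK' : (0 : ℝ) < K := by exact_mod_cast hK
  -- The coordinates of `S` fill a box of side at most `2 K d` around `v p`. Grid cells of width `w`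
  -- have preimages of diameter at most `K w = d / 2^j`, and a side meets `2 K² 2^j` of them. The
  -- summand `1` in `L` leaves room for the right end point of the box. One point of `S` is chosen
  -- per occupied cell.
  set w : ℝ := d / (K * 2 ^ j) with hw
  have hw0 : 0 < w := by positivity
  set L : ℕ := (2 * K ^ 2 + 1) * 2 ^ j with hL
  set b : X → Fin m → ℝ := fun x i => (v x i - v p i + K * d) / w with hb
  have hcoord : ∀ x ∈ S, ∀ y ∈ S, ∀ i, |v x i - v y i| ≤ K * d := fun x hx y hy i => by
    have h1 := (dist_le_pi_dist (v x) (v y) i).trans (hv x hx y hy)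
    rw [Real.dist_eq] at h1
    exact h1.trans (by gcongr; exact hS x hx y hy)
  have hb0 : ∀ x ∈ S, ∀ i, 0 ≤ b x i := fun x hx i =>
    div_nonneg (by linarith [(abs_le.1 (hcoord x hx p hp i)).1]) hw0.le
  have hbL : ∀ x ∈ S, ∀ i, ⌊b x i⌋₊ < L := fun x hx i => by
    rw [Nat.floor_lt (hb0 x hx i)]
    have : b x i ≤ 2 * K ^ 2 * 2 ^ j := by
      rw [hb]
      simp only
      rw [div_le_iff₀ hw0, hw]
      have : 2 * (K : ℝ) ^ 2 * 2 ^ j * (d / (K * 2 ^ j)) = 2 * (K * d) := by field_simp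
      rw [this]
      linarith [(abs_le.1 (hcoord x hx p hp i)).2]
    refine this.trans_lt ?_
    rw [hL]
    push_cast
    have : (0 : ℝ) < 2 ^ j := by positivity
    nlinarith
  have hLpos : 0 < L := by positivity
  set c : X → Fin m → Fin L := fun x i =>
    if h : ⌊b x i⌋₊ < L then ⟨⌊b x i⌋₊, h⟩ else ⟨0, hLpos⟩ with hc
  have hcS : ∀ x ∈ S, ∀ i, ((c x i : Fin L) : ℕ) = ⌊b x i⌋₊ := fun x hx i => by
    simp [hc, hbL x hx i]
  have hcd : ∀ x ∈ S, ∀ y ∈ S, c x = c y → dist x y ≤ d / 2 ^ j := fun x hx y hy hxy => by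
    refine (hv' x hx y hy).trans ?_
    have : dist (v x) (v y) ≤ w := by
      refine (dist_pi_le_iff hw0.le).2 fun i => ?_
      have hf : ⌊b x i⌋₊ = ⌊b y i⌋₊ := by rw [← hcS x hx i, ← hcS y hy i, hxy]
      have h1 := Nat.floor_le (hb0 x hx i)
      have h2 := Nat.lt_floor_add_one (b x i)
      have h3 := Nat.floor_le (hb0 y hy i)
      have h4 := Nat.lt_floor_add_one (b y i)
      rw [hf] at h1 h2
      have h5 : |b x i - b y i| ≤ 1 := abs_le.2 ⟨by linarith, by linarith⟩
      have h6 : b x i - b y i = (v x i - v y i) / w := by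
        simp only [hb]; rw [← sub_div]; ring
      rw [h6, abs_div, abs_of_pos hw0, div_le_one hw0] at h5
      rwa [Real.dist_eq]
    calc K * dist (v x) (v y) ≤ K * w := by gcongr
      _ = d / 2 ^ j := by rw [hw]; field_simp
  set sel : (Fin m → Fin L) → X := fun a =>
    if h : ∃ x ∈ S, c x = a then h.choose else p with hsel
  have hsel1 : ∀ a, sel a ∈ S := fun a => by
    simp only [hsel]
    split_ifs with h
    · exact h.choose_spec.1
    · exact hp
  have hsel2 : ∀ x ∈ S, c (sel (c x)) = c x := fun x hx => by
    have h : ∃ y ∈ S, c y = c x := ⟨x, hx, rfl⟩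
    simp only [hsel, dif_pos h]
    exact h.choose_spec.2
  refine ⟨Finset.univ.image sel, ?_, ?_, fun x hx => ⟨sel (c x), by simp, ?_⟩⟩
  · intro x hx
    obtain ⟨a, _, rfl⟩ := Finset.mem_image.1 (Finset.mem_coe.1 hx)
    exact hsel1 a
  · refine Finset.card_image_le.trans ?_
    rw [Finset.card_univ, Fintype.card_fun, Fintype.card_fin, Fintype.card_fin, hL, mul_pow,
      ← pow_mul]
  · exact hcd x hx _ (hsel1 _) (hsel2 x hx).symm

/-- In suitable charts an immersion is `u ↦ (u, 0)`, and a `C¹` chart of the ambient space is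
Lipschitz near a point together with its inverse. The ambient chart followed by projection to the
first factor is thus bi-Lipschitz on the image of a neighbourhood, for the ambient distance. -/
theorem exists_biLipschitz_chart {E M : Type*} [NormedAddCommGroup E] [NormedSpace ℝ E]
    [TopologicalSpace M] {m : ℕ} [ChartedSpace (EuclideanSpace ℝ (Fin m)) M] {ι : M → E} {p : M}
    (h : IsImmersionAt (𝓡 m) 𝓘(ℝ, E) 1 ι p) :
    ∃ V ∈ nhds p, ∃ (v : E → Fin m → ℝ) (K : ℕ), 0 < K ∧ ∀ x ∈ ι '' V, ∀ y ∈ ι '' V,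
      dist (v x) (v y) ≤ K * dist x y ∧ dist x y ≤ K * dist (v x) (v y) := by
  set φ := h.codChart with hφ
  set e : ((Fin m → ℝ) × h.complement) ≃L[ℝ] E :=
    ((EuclideanSpace.equiv (Fin m) ℝ).symm.prodCongr (.refl ℝ h.complement)).trans h.equiv
    with he
  have hat := h.codChart_mem_maximalAtlas
  have hsrc := h.mem_codChart_source
  have h1 : ContDiffAt ℝ 1 φ (ι p) :=
    (contMDiffOn_iff_contDiffOn.1 (contMDiffOn_of_mem_maximalAtlas hat)).contDiffAt
      (φ.open_source.mem_nhds hsrc)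
  have h2 : ContDiffAt ℝ 1 φ.symm (φ (ι p)) :=
    (contMDiffOn_iff_contDiffOn.1 (contMDiffOn_symm_of_mem_maximalAtlas hat)).contDiffAt
      (φ.open_target.mem_nhds (φ.map_source hsrc))
  obtain ⟨K1, s1, hs1, hL1⟩ := h1.exists_lipschitzOnWith
  obtain ⟨K2, s2, hs2, hL2⟩ := h2.exists_lipschitzOnWith
  have hcι : ContinuousAt ι p := h.continuousAt
  set V : Set M := h.domChart.source ∩ ι ⁻¹' s1 ∩ (φ ∘ ι) ⁻¹' s2 with hV
  have hVn : V ∈ nhds p := Filter.inter_mem (Filter.inter_mem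
    (h.domChart.open_source.mem_nhds h.mem_domChart_source) (hcι hs1))
    ((ContinuousAt.comp (h1.continuousAt) hcι) hs2)
  set v : E → Fin m → ℝ := fun z => (e.symm (φ z)).1 with hv
  have hchart : ∀ q ∈ V, φ (ι q) = e (v (ι q), 0) := fun q hq => by
    have hmem : h.domChart q ∈ (h.domChart.extend (𝓡 m)).target := by
      simpa using h.domChart.map_source hq.1.1
    have hw := h.writtenInCharts hmem
    have hl : h.domChart.symm (h.domChart q) = q := h.domChart.left_inv hq.1.1
    have hw' : φ (ι q) = e ((EuclideanSpace.equiv (Fin m) ℝ) (h.domChart q), 0) := by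
      simpa [hl, he] using hw
    simp only [hv]
    rw [hw']
    simp
  have hleft : ∀ q ∈ V, φ.symm (φ (ι q)) = ι q := fun q hq =>
    φ.left_inv (h.source_subset_preimage_source hq.1.1)
  obtain ⟨K, hK⟩ := exists_nat_ge
    (max (‖e.symm.toContinuousLinearMap‖₊ * K1) (K2 * ‖e.toContinuousLinearMap‖₊))
  refine ⟨V, hVn, v, K + 1, Nat.succ_pos _, ?_⟩
  rintro _ ⟨q, hq, rfl⟩ _ ⟨q', hq', rfl⟩
  constructor
  · calc dist (v (ι q)) (v (ι q')) ≤ dist (e.symm (φ (ι q))) (e.symm (φ (ι q'))) := by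
          rw [Prod.dist_eq]; exact le_max_left _ _
      _ ≤ ‖e.symm.toContinuousLinearMap‖₊ * dist (φ (ι q)) (φ (ι q')) :=
          e.symm.toContinuousLinearMap.lipschitz.dist_le_mul _ _
      _ ≤ ‖e.symm.toContinuousLinearMap‖₊ * (K1 * dist (ι q) (ι q')) := by
          gcongr; exact hL1.dist_le_mul _ hq.1.2 _ hq'.1.2
      _ = ((‖e.symm.toContinuousLinearMap‖₊ * K1 : NNReal) : ℝ) * dist (ι q) (ι q') := by
          push_cast; ring
      _ ≤ _ := by
          gcongr
          have h3 := (le_max_left _ _).trans hK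
          have h4 : ((‖e.symm.toContinuousLinearMap‖₊ * K1 : NNReal) : ℝ) ≤ K := by exact_mod_cast h3
          push_cast
          linarith
  · calc dist (ι q) (ι q') = dist (φ.symm (φ (ι q))) (φ.symm (φ (ι q'))) := by
          rw [hleft q hq, hleft q' hq']
      _ ≤ K2 * dist (φ (ι q)) (φ (ι q')) := hL2.dist_le_mul _ hq.2 _ hq'.2
      _ = K2 * dist (e (v (ι q), 0)) (e (v (ι q'), 0)) := by rw [hchart q hq, hchart q' hq']
      _ ≤ K2 * (‖e.toContinuousLinearMap‖₊ * dist (v (ι q), (0 : h.complement)) (v (ι q'), 0)) := by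
          gcongr; exact e.toContinuousLinearMap.lipschitz.dist_le_mul _ _
      _ = ((K2 * ‖e.toContinuousLinearMap‖₊ : NNReal) : ℝ) * dist (v (ι q)) (v (ι q')) := by
          rw [Prod.dist_eq]; push_cast; simp [mul_assoc]
      _ ≤ _ := by
          gcongr
          have h3 := (le_max_right _ _).trans hK
          have h4 : ((K2 * ‖e.toContinuousLinearMap‖₊ : NNReal) : ℝ) ≤ K := by exact_mod_cast h3
          push_cast
          linarith

/-- Subsets of a compact immersed `m`-dimensional manifold have nets of the cardinality that one
expects for dimension `m`. -/
theorem exists_finset_net_of_isImmersion {E M : Type*} [NormedAddCommGroup E] [NormedSpace ℝ E]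
    [TopologicalSpace M] [CompactSpace M] {m : ℕ} [ChartedSpace (EuclideanSpace ℝ (Fin m)) M]
    {ι : M → E} (h : ∀ p, IsImmersionAt (𝓡 m) 𝓘(ℝ, E) 1 ι p) :
    ∃ K : ℝ, 0 ≤ K ∧ ∀ S ⊆ Set.range ι, ∀ d : ℝ, 0 ≤ d → (∀ x ∈ S, ∀ y ∈ S, dist x y ≤ d) →
      ∀ j : ℕ, ∃ T : Finset E, ↑T ⊆ S ∧ (T.card : ℝ) ≤ K * 2 ^ (j * m) ∧
        ∀ x ∈ S, ∃ y ∈ T, dist x y ≤ d / 2 ^ j := by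
  classical
  choose V hV v K hK hv using fun p => exists_biLipschitz_chart (h p)
  obtain ⟨t, ht⟩ := finite_cover_nhds hV
  -- The constant adds up over a finite cover by charts fixed before `S`, `d` and `j`, so it is
  -- uniform over subsets and scales.
  refine ⟨∑ p ∈ t, (2 * (K p : ℝ) ^ 2 + 1) ^ m, by positivity, fun S hS d hd hSd j => ?_⟩
  have := fun p => exists_finset_net_of_biLipschitz (S := S ∩ ι '' V p) (v := v p) (hK p)
    (fun x hx y hy => (hv p x hx.2 y hy.2).1) (fun x hx y hy => (hv p x hx.2 y hy.2).2) hd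
    (fun x hx y hy => hSd x hx.1 y hy.1) j
  choose T hTS hTc hT using this
  refine ⟨t.biUnion T, ?_, ?_, fun x hx => ?_⟩
  · intro x hx
    obtain ⟨p, _, hp⟩ := Finset.mem_biUnion.1 (Finset.mem_coe.1 hx)
    exact (hTS p hp).1
  · rw [Finset.sum_mul]
    calc ((t.biUnion T).card : ℝ) ≤ ((∑ p ∈ t, (T p).card : ℕ) : ℝ) := by
          exact_mod_cast Finset.card_biUnion_le
      _ = ∑ p ∈ t, ((T p).card : ℝ) := by push_cast; rfl
      _ ≤ _ := Finset.sum_le_sum fun p _ => by exact_mod_cast hTc p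
  · obtain ⟨q, rfl⟩ := hS hx
    have hq : q ∈ ⋃ p ∈ t, V p := by rw [ht]; trivial
    obtain ⟨p, hp, hqp⟩ := Set.mem_iUnion₂.1 hq
    obtain ⟨y, hy, hxy⟩ := hT p (ι q) ⟨hx, q, hqp, rfl⟩
    exact ⟨y, Finset.mem_biUnion.2 ⟨p, hp, hy⟩, hxy⟩

/-! ### Exponential moments under negative drift. -/

theorem mul_exp_neg_cbrt_le {r : ℝ} (hr : 0 ≤ r) :
    r ^ 3 * Real.exp (-(18 * r)) ≤ 1 / 100 := by
  -- The cubic term of the exponential series, `18³ / 6 = 972`, is more than enough for `100`.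
  have h := Real.pow_div_factorial_le_exp (18 * r) (by positivity) 3
  have h3 : ((Nat.factorial 3 : ℕ) : ℝ) = 6 := by norm_num [Nat.factorial]
  rw [h3] at h
  rw [Real.exp_neg, ← div_eq_mul_inv, div_le_iff₀ (Real.exp_pos _)]
  have : 0 ≤ r ^ 3 := by positivity
  nlinarith

theorem exp_le_one_add_two_mul {u : ℝ} (h0 : 0 ≤ u) (h1 : u ≤ 1) : Real.exp u ≤ 1 + 2 * u := by
  have h := Real.abs_exp_sub_one_sub_id_le (x := u) (by rw [abs_of_nonneg h0]; exact h1)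
  have := (abs_le.1 h).2
  nlinarith

theorem meas_gt_le_exp_mul_lintegral {Ω : Type*} [MeasurableSpace Ω] {Q : Measure Ω}
    {Y : Ω → ℝ} (hY : Measurable Y) {θ b c : ℝ} (hθ : 0 ≤ θ)
    (h : ∫⁻ ω, ENNReal.ofReal (Real.exp (θ * Y ω)) ∂Q ≤ ENNReal.ofReal (Real.exp c)) :
    Q {ω | b < Y ω} ≤ ENNReal.ofReal (Real.exp (c - θ * b)) := by
  have hm : Measurable fun ω => ENNReal.ofReal (Real.exp (θ * Y ω)) := by fun_prop
  have h1 := mul_meas_ge_le_lintegral (μ := Q) hm (ENNReal.ofReal (Real.exp (θ * b)))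
  have hsub : {ω | b < Y ω} ⊆ {ω | ENNReal.ofReal (Real.exp (θ * b)) ≤
      ENNReal.ofReal (Real.exp (θ * Y ω))} := fun ω hω => by
    refine ENNReal.ofReal_le_ofReal (Real.exp_le_exp.2 ?_)
    exact mul_le_mul_of_nonneg_left (le_of_lt hω) hθ
  have h2 : ENNReal.ofReal (Real.exp (θ * b)) * Q {ω | b < Y ω} ≤ ENNReal.ofReal (Real.exp c) :=
    (mul_le_mul_right (measure_mono hsub) _).trans (h1.trans h)
  rw [sub_eq_add_neg, Real.exp_add, Real.exp_neg, ENNReal.ofReal_mul (Real.exp_pos _).le,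
    ENNReal.ofReal_inv_of_pos (Real.exp_pos _), ← div_eq_mul_inv]
  rw [ENNReal.le_div_iff_mul_le (Or.inl (by simp [Real.exp_pos])) (Or.inl ENNReal.ofReal_ne_top),
    mul_comm]
  exact h2

section Tails

variable {Ω : Type*} [MeasurableSpace Ω] {Q : Measure Ω} [IsProbabilityMeasure Q]

/-- The moment generating function of `x` is at most that of a random variable with sub-Gaussian
variance proxy `n / 4` and mean `-3 n ^ (2 / 3)`. -/
def NegDriftMGF (Q : Measure Ω) (x : Ω → ℝ) (n : ℕ) : Prop :=
  ∀ θ : ℝ, 0 ≤ θ → ∫⁻ ω, ENNReal.ofReal (Real.exp (θ * x ω)) ∂Q ≤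
    ENNReal.ofReal (Real.exp (θ ^ 2 * n / 8 - 3 * θ * (n : ℝ) ^ (2 / 3 : ℝ)))

theorem exists_cbrt {n : ℕ} (hn : 0 < n) :
    ∃ r : ℝ, 0 < r ∧ (n : ℝ) = r ^ 3 ∧ (n : ℝ) ^ (2 / 3 : ℝ) = r ^ 2 := by
  have hn' : (0 : ℝ) < n := by exact_mod_cast hn
  refine ⟨(n : ℝ) ^ (1 / 3 : ℝ), by positivity, ?_, ?_⟩
  · rw [← Real.rpow_natCast, ← Real.rpow_mul hn'.le]; norm_num
  · rw [← Real.rpow_natCast, ← Real.rpow_mul hn'.le]; norm_num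

/-- Taking positive parts costs an additive `1` in the exponential moment. The drift reduces the
other summand to `exp(2 s² n - 18 n^(1/3))`, and `10 s n > 1` forces `exp(-18 n^(1/3)) ≤ s² n`, so
that the sum is at most `exp(2 s² n) (1 + s² n) ≤ exp(3 s² n)`, with no constant factor per cell. -/
theorem NegDriftMGF.lintegral_exp_posPart_le {x : Ω → ℝ} {n : ℕ} (h : NegDriftMGF Q x n)
    {s : ℝ} (hs : 0 ≤ s) (hn : 1 < 10 * s * n) :
    ∫⁻ ω, ENNReal.ofReal (Real.exp (4 * s * max (x ω) 0)) ∂Q ≤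
      ENNReal.ofReal (Real.exp (3 * s ^ 2 * n)) := by
  have hn0 : 0 < n := by
    rcases Nat.eq_zero_or_pos n with rfl | h0
    · norm_num at hn
    · exact h0
  obtain ⟨r, hr, hr3, hr2⟩ := exists_cbrt hn0
  -- `12 / r` minimizes `θ² n / 8 - 3 θ n^(2/3)`, with minimum `-18 r`. Raising the exponent from `4
  -- s` to `θ` is harmless where `x` is positive.
  set θ := max (4 * s) (12 / r) with hθ
  have hθ0 : 0 ≤ θ := le_max_of_le_left (by positivity)
  have hθs : 4 * s ≤ θ := le_max_left _ _
  have hexp : θ ^ 2 * n / 8 - 3 * θ * (n : ℝ) ^ (2 / 3 : ℝ) ≤ 2 * s ^ 2 * n + -(18 * r) := by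
    rw [hr2, hr3]
    rcases le_total (4 * s) (12 / r) with h4 | h4
    · rw [hθ, max_eq_right h4]
      have : (12 / r) ^ 2 * r ^ 3 / 8 - 3 * (12 / r) * r ^ 2 = -(18 * r) := by
        field_simp; ring
      rw [this]
      have : 0 ≤ 2 * s ^ 2 * r ^ 3 := by positivity
      linarith
    · rw [hθ, max_eq_left h4]
      rw [div_le_iff₀ hr] at h4
      nlinarith
  have hq : Real.exp (-(18 * r)) ≤ s ^ 2 * n := by
    have h1 := mul_exp_neg_cbrt_le hr.le
    rw [← hr3] at h1
    have hn' : (0 : ℝ) < n := by exact_mod_cast hn0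
    have h2 : 1 ≤ 100 * (s * n) ^ 2 := by nlinarith
    have h3 : n * Real.exp (-(18 * r)) ≤ n * (s ^ 2 * n) := by nlinarith
    exact le_of_mul_le_mul_left h3 hn'
  calc ∫⁻ ω, ENNReal.ofReal (Real.exp (4 * s * max (x ω) 0)) ∂Q
      ≤ ∫⁻ ω, (1 + ENNReal.ofReal (Real.exp (θ * x ω))) ∂Q := by
        refine lintegral_mono fun ω => ?_
        rcases le_total (x ω) 0 with hx | hx
        · simp [max_eq_right hx]
        · rw [max_eq_left hx]
          refine le_add_left (ENNReal.ofReal_le_ofReal (Real.exp_le_exp.2 ?_))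
          exact mul_le_mul_of_nonneg_right hθs hx
    _ = 1 + ∫⁻ ω, ENNReal.ofReal (Real.exp (θ * x ω)) ∂Q := by
        rw [lintegral_add_left measurable_const]; simp
    _ ≤ 1 + ENNReal.ofReal (Real.exp (2 * s ^ 2 * n + -(18 * r))) := by
        gcongr
        exact (h θ hθ0).trans (ENNReal.ofReal_le_ofReal (Real.exp_le_exp.2 hexp))
    _ = ENNReal.ofReal (1 + Real.exp (2 * s ^ 2 * n) * Real.exp (-(18 * r))) := by
        rw [ENNReal.ofReal_add zero_le_one (by positivity), ENNReal.ofReal_one, Real.exp_add]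
    _ ≤ ENNReal.ofReal (Real.exp (3 * s ^ 2 * n)) := by
        refine ENNReal.ofReal_le_ofReal ?_
        have h1 : 1 ≤ Real.exp (2 * s ^ 2 * n) := Real.one_le_exp (by positivity)
        have h2 := Real.add_one_le_exp (s ^ 2 * n)
        have e : Real.exp (3 * s ^ 2 * n) = Real.exp (2 * s ^ 2 * n) * Real.exp (s ^ 2 * n) := by
          rw [← Real.exp_add]; congr 1; ring
        rw [e]
        nlinarith

/-- In a small cell `s² n` may not absorb the tail, so only the sign of `x` is tracked. Chernoff at
`12 / r` bounds the probability of `x > 0` by `exp(-18 r)`, and `n exp(-18 r) ≤ 1/100` for all `n`.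
A cell thus costs at most `s / 5` in the exponent, whatever its size; `10 s n ≤ 1` linearizes the
exponential. -/
theorem NegDriftMGF.lintegral_exp_indicator_le {x : Ω → ℝ} (hx : Measurable x) {n : ℕ}
    (h : NegDriftMGF Q x n) {s : ℝ} (hs : 0 ≤ s) (hn : 10 * s * n ≤ 1) :
    ∫⁻ ω, ENNReal.ofReal (Real.exp (10 * s * (n * if 0 < x ω then 1 else 0))) ∂Q ≤
      ENNReal.ofReal (Real.exp (s / 5)) := by
  rcases Nat.eq_zero_or_pos n with rfl | hn0
  · simp
    positivity
  obtain ⟨r, hr, hr3, hr2⟩ := exists_cbrt hn0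
  have hexp : (12 / r) ^ 2 * n / 8 - 3 * (12 / r) * (n : ℝ) ^ (2 / 3 : ℝ) = -(18 * r) := by
    rw [hr2, hr3]; field_simp; ring
  have hq := mul_exp_neg_cbrt_le hr.le
  rw [← hr3] at hq
  calc ∫⁻ ω, ENNReal.ofReal (Real.exp (10 * s * (n * if 0 < x ω then 1 else 0))) ∂Q
      ≤ ∫⁻ ω, (1 + ENNReal.ofReal (20 * s * n) *
          ENNReal.ofReal (Real.exp (12 / r * x ω))) ∂Q := by
        refine lintegral_mono fun ω => ?_
        split_ifs with hxω
        · rw [mul_one, ← ENNReal.ofReal_mul (by positivity), ← ENNReal.ofReal_one,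
            ← ENNReal.ofReal_add zero_le_one (by positivity)]
          refine ENNReal.ofReal_le_ofReal ?_
          have h1 := exp_le_one_add_two_mul (u := 10 * s * n) (by positivity) hn
          have h2 : 1 ≤ Real.exp (12 / r * x ω) := Real.one_le_exp (by positivity)
          have h3 : 0 ≤ 20 * s * n := by positivity
          nlinarith
        · simp
    _ = 1 + ENNReal.ofReal (20 * s * n) *
          ∫⁻ ω, ENNReal.ofReal (Real.exp (12 / r * x ω)) ∂Q := by
        rw [lintegral_add_left measurable_const, lintegral_const_mul _ (by fun_prop)]; simp
    _ ≤ 1 + ENNReal.ofReal (20 * s * n) * ENNReal.ofReal (Real.exp (-(18 * r))) := by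
        gcongr
        rw [← hexp]
        exact h _ (by positivity)
    _ = ENNReal.ofReal (1 + 20 * s * (n * Real.exp (-(18 * r)))) := by
        rw [← ENNReal.ofReal_mul (by positivity), ← ENNReal.ofReal_one,
          ← ENNReal.ofReal_add zero_le_one (by positivity)]
        congr 1; ring
    _ ≤ ENNReal.ofReal (Real.exp (s / 5)) := by
        refine ENNReal.ofReal_le_ofReal ?_
        have := Real.add_one_le_exp (s / 5)
        nlinarith

variable {κ : Type*} [Fintype κ]

/-- Chernoff at `4 s`: the exponent is `3 s² N - 4 s · N s = -N s²`. The number of cells does not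
enter. -/
theorem meas_sum_posPart_gt_le {x : κ → Ω → ℝ} (hx : ∀ i, Measurable (x i)) (n : κ → ℕ)
    (h : ∀ i, NegDriftMGF Q (x i) (n i))
    (hprod : ∀ (A : Finset κ) (g : κ → ℝ → ℝ≥0∞), (∀ i, Measurable (g i)) →
      ∫⁻ ω, ∏ i ∈ A, g i (x i ω) ∂Q = ∏ i ∈ A, ∫⁻ ω, g i (x i ω) ∂Q)
    {s : ℝ} (hs : 0 ≤ s) {N : ℝ} (hN : ∑ i, (n i : ℝ) ≤ N) :
    Q {ω | N * s < ∑ i with 1 < 10 * s * n i, max (x i ω) 0} ≤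
      ENNReal.ofReal (Real.exp (-(N * s ^ 2))) := by
  set A : Finset κ := {i | 1 < 10 * s * n i} with hA
  have hm : Measurable fun ω => ∑ i ∈ A, max (x i ω) 0 := by fun_prop
  refine (meas_gt_le_exp_mul_lintegral hm (θ := 4 * s) (c := 3 * s ^ 2 * N) (by positivity)
    ?_).trans (ENNReal.ofReal_le_ofReal (Real.exp_le_exp.2 (by nlinarith)))
  calc ∫⁻ ω, ENNReal.ofReal (Real.exp (4 * s * ∑ i ∈ A, max (x i ω) 0)) ∂Q
      = ∫⁻ ω, ∏ i ∈ A, (fun u => ENNReal.ofReal (Real.exp (4 * s * max u 0))) (x i ω) ∂Q := by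
        congr 1; ext ω
        rw [Finset.mul_sum, Real.exp_sum, ENNReal.ofReal_prod_of_nonneg fun _ _ =>
          (Real.exp_pos _).le]
    _ = ∏ i ∈ A, ∫⁻ ω, ENNReal.ofReal (Real.exp (4 * s * max (x i ω) 0)) ∂Q :=
        hprod A (fun _ u => ENNReal.ofReal (Real.exp (4 * s * max u 0))) fun _ => by fun_prop
    _ ≤ ∏ i ∈ A, ENNReal.ofReal (Real.exp (3 * s ^ 2 * n i)) :=
        Finset.prod_le_prod' fun i hi =>
          (h i).lintegral_exp_posPart_le hs (by simpa [hA] using hi)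
    _ = ENNReal.ofReal (Real.exp (∑ i ∈ A, 3 * s ^ 2 * n i)) := by
        rw [Real.exp_sum, ENNReal.ofReal_prod_of_nonneg fun _ _ => (Real.exp_pos _).le]
    _ ≤ _ := by
        refine ENNReal.ofReal_le_ofReal (Real.exp_le_exp.2 ?_)
        rw [← Finset.mul_sum]
        gcongr
        refine le_trans ?_ hN
        exact Finset.sum_le_sum_of_subset_of_nonneg (Finset.subset_univ _) fun _ _ _ => by
          positivity

/-- Chernoff at `10 s`: at most `t N` cells contribute `s / 5` each, against `10 s · t N / 5`, which
leaves `-(9/5) s t N ≤ -N s²`. -/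
theorem meas_sum_indicator_gt_le {x : κ → Ω → ℝ} (hx : ∀ i, Measurable (x i)) (n : κ → ℕ)
    (h : ∀ i, NegDriftMGF Q (x i) (n i))
    (hprod : ∀ (A : Finset κ) (g : κ → ℝ → ℝ≥0∞), (∀ i, Measurable (g i)) →
      ∫⁻ ω, ∏ i ∈ A, g i (x i ω) ∂Q = ∏ i ∈ A, ∫⁻ ω, g i (x i ω) ∂Q)
    {s t : ℝ} (hs : 0 ≤ s) (hst : s ≤ t) {N : ℝ} (hN : 0 ≤ N) (hk : Fintype.card κ ≤ t * N) :
    Q {ω | t * N / 5 < ∑ i with ¬ 1 < 10 * s * n i, (n i : ℝ) * if 0 < x i ω then (1 : ℝ) else 0} ≤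
      ENNReal.ofReal (Real.exp (-(N * s ^ 2))) := by
  set A : Finset κ := {i | ¬ 1 < 10 * s * n i} with hA
  have hind : Measurable fun u : ℝ => if 0 < u then (1 : ℝ) else 0 :=
    Measurable.ite measurableSet_Ioi measurable_const measurable_const
  have hm : Measurable fun ω => ∑ i ∈ A, (n i : ℝ) * if 0 < x i ω then (1 : ℝ) else 0 :=
    Finset.measurable_sum _ fun i _ => (hind.comp (hx i)).const_mul _
  refine (meas_gt_le_exp_mul_lintegral hm (θ := 10 * s) (c := t * N * (s / 5)) (by positivity)
    ?_).trans (ENNReal.ofReal_le_ofReal (Real.exp_le_exp.2 ?_))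
  · calc ∫⁻ ω, ENNReal.ofReal
          (Real.exp (10 * s * ∑ i ∈ A, (n i : ℝ) * if 0 < x i ω then (1 : ℝ) else 0)) ∂Q
        = ∫⁻ ω, ∏ i ∈ A, (fun i u => ENNReal.ofReal
            (Real.exp (10 * s * ((n i : ℝ) * if 0 < u then (1 : ℝ) else 0)))) i (x i ω) ∂Q := by
          congr 1; ext ω
          rw [Finset.mul_sum, Real.exp_sum, ENNReal.ofReal_prod_of_nonneg fun _ _ =>
            (Real.exp_pos _).le]
      _ = ∏ i ∈ A, ∫⁻ ω, ENNReal.ofReal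
            (Real.exp (10 * s * ((n i : ℝ) * if 0 < x i ω then (1 : ℝ) else 0))) ∂Q :=
          hprod A (fun i u => ENNReal.ofReal
            (Real.exp (10 * s * ((n i : ℝ) * if 0 < u then (1 : ℝ) else 0)))) fun i =>
              ENNReal.measurable_ofReal.comp (Real.measurable_exp.comp
                ((hind.const_mul _).const_mul _))
      _ ≤ ∏ i ∈ A, ENNReal.ofReal (Real.exp (s / 5)) :=
          Finset.prod_le_prod' fun i hi =>
            (h i).lintegral_exp_indicator_le (hx i) hs (by simpa [hA] using hi)
      _ = ENNReal.ofReal (Real.exp (A.card * (s / 5))) := by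
          rw [Finset.prod_const, ← ENNReal.ofReal_pow (Real.exp_pos _).le, ← Real.exp_nat_mul]
      _ ≤ _ := by
          refine ENNReal.ofReal_le_ofReal (Real.exp_le_exp.2 ?_)
          gcongr
          refine le_trans ?_ hk
          exact_mod_cast Finset.card_le_univ A
  · have h1 : 0 ≤ N * s := by positivity
    nlinarith [mul_le_mul_of_nonneg_left hst h1, mul_nonneg h1 hs]

end Tails

/-! ### Fluctuations of the discrepancy in one cell. -/

/-- The excess of the normalized discrepancy of the sample points in `I` over its expected order
of magnitude. -/
noncomputable def discExcess {E ι : Type*} [MetricSpace E] [MeasurableSpace E] (m : ℕ) (C : ℝ)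
    (ν : Measure E) (d : ℝ) (I : Finset ι) (D : ι → E) : ℝ :=
  lipDisc ν d I D / d - C * (I.card : ℝ) ^ (1 - 1 / (m : ℝ))


section Excess

variable {E : Type*} [MetricSpace E] [MeasurableSpace E] [BorelSpace E]
  [SecondCountableTopology E]

theorem lipDisc_div_mem_Icc {ι : Type*} {ν : Measure E} [IsProbabilityMeasure ν] {d : ℝ}
    (hd : 0 ≤ d) (I : Finset ι) (D : ι → E) :
    lipDisc ν d I D / d ∈ Set.Icc (0 : ℝ) I.card := by
  refine ⟨div_nonneg (lipDisc_nonneg hd I D) hd, ?_⟩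
  exact div_le_of_le_mul₀ hd (by positivity) (by rw [mul_comm]; exact lipDisc_le hd I D)

/-- Replacing one point of `I` moves the normalized discrepancy by at most `1`, so McDiarmid gives
the quadratic term. The surplus `3` over the constant `C` of the mean bound gives the drift, and `m
≥ 3` makes `1 - 1/m ≥ 2/3`. -/
theorem negDriftMGF_discExcess {m N : ℕ} (hm : 3 ≤ m) {C : ℝ} (hC : 0 ≤ C) {ν : Measure E}
    [IsProbabilityMeasure ν] (I : Finset (Fin N)) (ρ : Fin N → Measure E)
    [∀ i, IsProbabilityMeasure (ρ i)] {d : ℝ} (hd : 0 ≤ d)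
    (hE : ∫ D, lipDisc ν d I D ∂Measure.pi ρ ≤ C * d * (I.card : ℝ) ^ (1 - 1 / (m : ℝ))) :
    NegDriftMGF (Measure.pi ρ) (discExcess m (C + 3) ν d I) I.card := by
  intro θ hθ
  set n : ℝ := ((I.card : ℕ) : ℝ) with hn
  set F : (Fin N → E) → ℝ := fun D => θ * (lipDisc ν d I D / d) with hF
  have hmeas : Measurable fun D : Fin N → E => lipDisc ν d I D / d :=
    (measurable_lipDisc hd I).div_const d
  have hFm : Measurable F := hmeas.const_mul θ
  have hFI : ∀ D, F D ∈ Set.Icc 0 (θ * n) := fun D =>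
    ⟨mul_nonneg hθ (lipDisc_div_mem_Icc hd I D).1,
      mul_le_mul_of_nonneg_left (lipDisc_div_mem_Icc hd I D).2 hθ⟩
  have hbound := integral_exp_sub_integral_pi_le ρ F hFm (θ * n)
    (fun D => by rw [abs_of_nonneg (hFI D).1]; exact (hFI D).2)
    (fun i => if i ∈ I then θ else 0) (fun i D z => by
      have h1 := abs_lipDisc_update_sub_le (ν := ν) hd I D i z
      rw [hF]
      simp only
      rw [← mul_sub, ← sub_div, abs_mul, abs_of_nonneg hθ, abs_div, abs_of_nonneg hd]
      split_ifs at h1 ⊢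
      · exact mul_le_of_le_one_right hθ (div_le_one_of_le₀ h1 hd)
      · have : |lipDisc ν d I (Function.update D i z) - lipDisc ν d I D| = 0 :=
          le_antisymm h1 (abs_nonneg _)
        simp [this])
  have hsum : (∑ i, (if i ∈ I then θ else 0) ^ 2) / 8 = θ ^ 2 * n / 8 := by
    simp only [ite_pow, ne_eq, OfNat.ofNat_ne_zero, not_false_eq_true, zero_pow]
    rw [Finset.sum_ite_mem, Finset.univ_inter, Finset.sum_const, nsmul_eq_mul]
    ring
  rw [hsum] at hbound
  have hIF : ∫ D, F D ∂Measure.pi ρ ≤ θ * (C * n ^ (1 - 1 / (m : ℝ))) := by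
    rw [hF, integral_const_mul, integral_div]
    refine mul_le_mul_of_nonneg_left (div_le_of_le_mul₀ hd (by positivity) ?_) hθ
    linarith
  have hpow : n ^ (2 / 3 : ℝ) ≤ n ^ (1 - 1 / (m : ℝ)) := by
    have hm3 : 1 / (m : ℝ) ≤ 1 / 3 := by
      have : (3 : ℝ) ≤ m := by exact_mod_cast hm
      gcongr
    rcases Nat.eq_zero_or_pos I.card with h0 | h0
    · have e1 : (1 - 1 / (m : ℝ)) ≠ 0 := by intro h; linarith
      rw [hn, h0, Nat.cast_zero, Real.zero_rpow e1, Real.zero_rpow (by norm_num)]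
    · refine Real.rpow_le_rpow_of_exponent_le ?_ (by linarith)
      rw [hn]; exact_mod_cast h0
  have hpt : ∀ D, Real.exp (θ * discExcess m (C + 3) ν d I D) ≤
      Real.exp (-(3 * θ * n ^ (2 / 3 : ℝ))) * Real.exp (F D - ∫ D, F D ∂Measure.pi ρ) :=
    fun D => by
      rw [← Real.exp_add, Real.exp_le_exp, discExcess, mul_sub]
      have := mul_le_mul_of_nonneg_left hpow hθ
      simp only [← hn, hF] at hIF ⊢
      nlinarith
  have hint : Integrable (fun D => Real.exp (F D - ∫ D, F D ∂Measure.pi ρ)) (Measure.pi ρ) := by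
    refine Integrable.of_bound
      (Real.measurable_exp.comp (hFm.sub_const _)).aestronglyMeasurable
      (Real.exp (θ * n - ∫ D, F D ∂Measure.pi ρ)) (Filter.Eventually.of_forall fun D => ?_)
    rw [Real.norm_eq_abs, Real.abs_exp, Real.exp_le_exp]
    linarith [(hFI D).2]
  calc ∫⁻ D, ENNReal.ofReal (Real.exp (θ * discExcess m (C + 3) ν d I D)) ∂Measure.pi ρ
      ≤ ∫⁻ D, ENNReal.ofReal (Real.exp (-(3 * θ * n ^ (2 / 3 : ℝ))) *
          Real.exp (F D - ∫ D, F D ∂Measure.pi ρ)) ∂Measure.pi ρ :=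
        lintegral_mono fun D => ENNReal.ofReal_le_ofReal (hpt D)
    _ = ENNReal.ofReal (∫ D, Real.exp (-(3 * θ * n ^ (2 / 3 : ℝ))) *
          Real.exp (F D - ∫ D, F D ∂Measure.pi ρ) ∂Measure.pi ρ) :=
        (ofReal_integral_eq_lintegral_ofReal (hint.const_mul _)
          (Filter.Eventually.of_forall fun D => by positivity)).symm
    _ ≤ ENNReal.ofReal (Real.exp (θ ^ 2 * n / 8 - 3 * θ * n ^ (2 / 3 : ℝ))) := by
        refine ENNReal.ofReal_le_ofReal ?_
        rw [integral_const_mul, sub_eq_neg_add, Real.exp_add]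
        gcongr

theorem measurable_discExcess {ι : Type*} [Fintype ι] {m : ℕ} {C : ℝ} {ν : Measure E}
    [IsProbabilityMeasure ν] {d : ℝ} (hd : 0 ≤ d) (I : Finset ι) :
    Measurable (discExcess m C ν d I) :=
  ((measurable_lipDisc hd I).div_const d).sub_const _

end Excess

/-! ### Conditioning on the cells of the sample points. -/

section Cells

variable {E κ : Type*} [MeasurableSpace E] [Fintype κ]

open Classical in
/-- The law of a sample point conditional on it lying in `A`. -/
noncomputable def cellMeasure (μ : Measure E) (A : Set E) : Measure E :=
  if μ A = 0 then μ else μ[|A]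

instance (μ : Measure E) [IsProbabilityMeasure μ] (A : Set E) :
    IsProbabilityMeasure (cellMeasure μ A) := by
  unfold cellMeasure
  split_ifs with h
  · infer_instance
  · exact cond_isProbabilityMeasure h

open Classical in
/-- The indices of the sample points that lie in the cell `P i`. -/
noncomputable def cellIndices {N : ℕ} (P : κ → Set E) (D : Fin N → E) (i : κ) : Finset (Fin N) :=
  {n | D n ∈ P i}

theorem pi_restrict_eq_smul {ι : Type*} [Fintype ι] (μ : Measure E) [IsProbabilityMeasure μ]
    (A : ι → Set E) (hA : ∀ i, MeasurableSet (A i)) (h0 : ∀ i, μ (A i) ≠ 0) :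
    Measure.pi (fun i => μ.restrict (A i)) =
      (∏ i, μ (A i)) • Measure.pi (fun i => cellMeasure μ (A i)) := by
  refine Measure.pi_eq fun s hs => ?_
  rw [Measure.smul_apply, Measure.pi_pi, smul_eq_mul, ← Finset.prod_mul_distrib]
  refine Finset.prod_congr rfl fun i _ => ?_
  rw [cellMeasure, if_neg (h0 i), cond_apply (hA i), Measure.restrict_apply (hs i), ← mul_assoc,
    ENNReal.mul_inv_cancel (h0 i) (measure_ne_top _ _), one_mul, Set.inter_comm]

/-- The law of total probability for the assignment of the sample points to the cells. -/
theorem pi_measure_le_of_forall_assignment {N : ℕ} (μ : Measure E) [IsProbabilityMeasure μ]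
    (P : κ → Set E) (hP : ∀ i, MeasurableSet (P i)) (hdisj : Pairwise fun i j => Disjoint (P i) (P j))
    (hU : ∀ᵐ z ∂μ, z ∈ ⋃ i, P i) (B : Set (Fin N → E)) (ε : ℝ≥0∞)
    (hB : ∀ a : Fin N → κ, (∀ n, μ (P (a n)) ≠ 0) → ∃ B' : Set (Fin N → E),
      (∀ D ∈ B, (∀ n, D n ∈ P (a n)) → D ∈ B') ∧
      Measure.pi (fun n => cellMeasure μ (P (a n))) B' ≤ ε) :
    Measure.pi (fun _ : Fin N => μ) B ≤ ε := by
  classical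
  have hsum : ∑ i, μ (P i) = 1 := by
    rw [← tsum_fintype (L := .unconditional κ), ← measure_iUnion hdisj hP]
    exact (prob_compl_eq_zero_iff (MeasurableSet.iUnion hP)).1 hU
  -- On the box of an assignment the product measure is a multiple of the product of the cell laws.
  -- The weights of the boxes add up to `(∑ μ (P i)) ^ N = 1`.
  have hbox : ∀ a : Fin N → κ, Measure.pi (fun _ : Fin N => μ)
      (B ∩ Set.univ.pi fun n => P (a n)) ≤ (∏ n, μ (P (a n))) * ε := fun a => by
    by_cases h0 : ∀ n, μ (P (a n)) ≠ 0
    · obtain ⟨B', hB', hle⟩ := hB a h0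
      calc Measure.pi (fun _ : Fin N => μ) (B ∩ Set.univ.pi fun n => P (a n))
          ≤ Measure.pi (fun _ : Fin N => μ) (B' ∩ Set.univ.pi fun n => P (a n)) :=
            measure_mono fun D hD => ⟨hB' D hD.1 fun n => hD.2 n trivial, hD.2⟩
        _ = (Measure.pi fun _ : Fin N => μ).restrict (Set.univ.pi fun n => P (a n)) B' :=
            (Measure.restrict_apply' (MeasurableSet.univ_pi fun n => hP _)).symm
        _ = (∏ n, μ (P (a n))) * Measure.pi (fun n => cellMeasure μ (P (a n))) B' := by
            rw [Measure.restrict_pi_pi, pi_restrict_eq_smul μ _ (fun n => hP _) h0]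
            rfl
        _ ≤ _ := by gcongr
    · push Not at h0
      obtain ⟨n, hn⟩ := h0
      refine le_trans (measure_mono Set.inter_subset_right) ?_
      rw [Measure.pi_pi, Finset.prod_eq_zero (Finset.mem_univ n) hn]
      exact zero_le
  have hcover : ∀ᵐ D ∂Measure.pi (fun _ : Fin N => μ), ∀ n, D n ∈ ⋃ i, P i :=
    ae_all_iff.2 fun n => (measurePreserving_eval (fun _ : Fin N => μ) n).quasiMeasurePreserving.ae
      hU
  calc Measure.pi (fun _ : Fin N => μ) B
      ≤ Measure.pi (fun _ : Fin N => μ) (⋃ a : Fin N → κ, B ∩ Set.univ.pi fun n => P (a n)) := by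
        refine measure_mono_ae ?_
        filter_upwards [hcover] with D hD hDB
        choose a ha using fun n => Set.mem_iUnion.1 (hD n)
        exact Set.mem_iUnion.2 ⟨a, hDB, fun n _ => ha n⟩
    _ ≤ ∑ a : Fin N → κ, Measure.pi (fun _ : Fin N => μ) (B ∩ Set.univ.pi fun n => P (a n)) :=
        measure_iUnion_fintype_le _ _
    _ ≤ ∑ a : Fin N → κ, (∏ n, μ (P (a n))) * ε := Finset.sum_le_sum fun a _ => hbox a
    _ = (∑ i, μ (P i)) ^ N * ε := by rw [← Finset.sum_mul, Fintype.sum_pow]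
    _ = ε := by rw [hsum, one_pow, one_mul]

theorem pi_measure_hoeffding_le {N : ℕ} (hN : 0 < N) (μ : Measure E) [IsProbabilityMeasure μ]
    {A : Set E} (hA : MeasurableSet A) {τ : ℝ} (hτ : 0 ≤ τ) :
    Measure.pi (fun _ : Fin N => μ) {D | N * τ ≤ ∑ n, (μ.real A - A.indicator 1 (D n))} ≤
      ENNReal.ofReal (Real.exp (-(2 * N * τ ^ 2))) := by
  have hYm : Measurable fun z : E => -A.indicator (1 : E → ℝ) z :=
    (measurable_one.indicator hA).neg
  have hmean : ∀ n : Fin N, ∫ D : Fin N → E, -A.indicator (1 : E → ℝ) (D n)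
      ∂Measure.pi (fun _ : Fin N => μ) = -μ.real A := fun n => by
    rw [integral_comp_eval (X := fun _ => E) (μ := fun _ : Fin N => μ) (i := n)
      (f := fun z => -A.indicator (1 : E → ℝ) z) hYm.aestronglyMeasurable, integral_neg,
      integral_indicator_one hA]
  have hsub : ∀ n : Fin N, HasSubgaussianMGF
      (fun D : Fin N → E => -A.indicator (1 : E → ℝ) (D n) - -μ.real A)
      ((‖(0 : ℝ) - (-1)‖₊ / 2) ^ 2) (Measure.pi fun _ : Fin N => μ) := fun n => by
    rw [← hmean n]
    refine hasSubgaussianMGF_of_mem_Icc (hYm.comp (measurable_pi_apply n)).aemeasurable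
      (Filter.Eventually.of_forall fun D => ?_)
    by_cases h : D n ∈ A <;> simp [h]
  have hind : iIndepFun (fun (i : Fin N) (x : Fin N → E) =>
      -A.indicator (1 : E → ℝ) (x i) - -μ.real A) (Measure.pi fun _ : Fin N => μ) :=
    iIndepFun_pi (X := fun _ z => -A.indicator (1 : E → ℝ) z - -μ.real A)
      fun i => (hYm.sub_const _).aemeasurable
  have h := HasSubgaussianMGF.measure_sum_ge_le_of_iIndepFun hind (s := Finset.univ) (fun n _ => hsub n)
    (ε := N * τ) (by positivity)
  have e1 : -(N * τ) ^ 2 / (2 * ∑ _i : Fin N, (((‖(0 : ℝ) - (-1)‖₊ / 2) ^ 2 : NNReal) : ℝ)) =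
      -(2 * N * τ ^ 2) := by
    have hN' : (N : ℝ) ≠ 0 := by exact_mod_cast hN.ne'
    simp
    field_simp
  have h' : (Measure.pi fun _ : Fin N => μ).real
      {D | N * τ ≤ ∑ n, (μ.real A - A.indicator 1 (D n))} ≤ Real.exp (-(2 * N * τ ^ 2)) := by
    rw [← e1]
    convert h using 3
    · ext D
      simp only [sub_neg_eq_add, neg_add_eq_sub]
    · push_cast
      rfl
  rw [← ENNReal.ofReal_toReal (measure_ne_top _ _)]
  exact ENNReal.ofReal_le_ofReal h'

end Cells

/-! ### Probability of a good sample. -/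

section Good

variable {E κ : Type*} [MetricSpace E] [MeasurableSpace E] [BorelSpace E]
  [SecondCountableTopology E] [Fintype κ]

/-- The properties of a sample from which the bound on the risk is derived: in the cells with many
sample points the discrepancies are not much larger than expected on average, in the cells with few
sample points they are rarely larger than expected, and the cell frequencies are close to the cell
probabilities. -/
structure GoodSample {N : ℕ} (μ : Measure E) (P : κ → Set E) (m : ℕ) (C s t : ℝ)
    (D : Fin N → E) : Prop where
  large : ∑ i with 1 < 10 * s * (cellIndices P D i).card,
    max (discExcess m C (cellMeasure μ (P i)) (Metric.diam (P i)) (cellIndices P D i) D) 0 ≤ N * s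
  small : ∑ i with ¬ 1 < 10 * s * (cellIndices P D i).card, ((cellIndices P D i).card : ℝ) *
    (if 0 < discExcess m C (cellMeasure μ (P i)) (Metric.diam (P i)) (cellIndices P D i) D
      then (1 : ℝ) else 0) ≤ t * N / 5
  freq : ∀ S : Finset κ, ∑ i ∈ S, (μ.real (P i) - (cellIndices P D i).card / N) ≤ 4 / 5 * t

/-- For a fixed assignment `a` the index sets `I i` are deterministic and disjoint, so the excesses
are independent. Each has negative drift by the net bound for `P i ∩ R`. -/
theorem pi_measure_bad_cells_le {N m : ℕ} (hm : 3 ≤ m) {K : ℝ} {R : Set E}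
    (hK : ∀ S ⊆ R, ∀ d : ℝ, 0 ≤ d → (∀ x ∈ S, ∀ y ∈ S, dist x y ≤ d) →
      ∀ j : ℕ, ∃ T : Finset E, ↑T ⊆ S ∧ (T.card : ℝ) ≤ K * 2 ^ (j * m) ∧
        ∀ x ∈ S, ∃ y ∈ T, dist x y ≤ d / 2 ^ j)
    (μ : Measure E) [IsProbabilityMeasure μ] (hR : ∀ᵐ z ∂μ, z ∈ R)
    (P : κ → Set E) (hP : ∀ i, MeasurableSet (P i)) (hb : ∀ i, Bornology.IsBounded (P i))
    (a : Fin N → κ) (ha : ∀ n, μ (P (a n)) ≠ 0) (I : κ → Finset (Fin N))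
    (hI : ∀ i n, n ∈ I i ↔ a n = i)
    {s t : ℝ} (hs : 0 ≤ s) (hst : s ≤ t) (hk : Fintype.card κ ≤ t * N) :
    Measure.pi (fun n => cellMeasure μ (P (a n)))
      ({D | N * s < ∑ i with 1 < 10 * s * (I i).card,
          max (discExcess m (4 + 5 * √(K * 2 ^ m) + 3) (cellMeasure μ (P i)) (Metric.diam (P i))
            (I i) D) 0} ∪
        {D | t * N / 5 < ∑ i with ¬ 1 < 10 * s * (I i).card, ((I i).card : ℝ) *
          (if 0 < discExcess m (4 + 5 * √(K * 2 ^ m) + 3) (cellMeasure μ (P i))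
            (Metric.diam (P i)) (I i) D then (1 : ℝ) else 0)}) ≤
      ENNReal.ofReal (2 * Real.exp (-(N * s ^ 2))) := by
  classical
  set C : ℝ := 4 + 5 * √(K * 2 ^ m) with hC
  have hC0 : 0 ≤ C := by positivity
  set x : κ → (Fin N → E) → ℝ := fun i =>
    discExcess m (C + 3) (cellMeasure μ (P i)) (Metric.diam (P i)) (I i) with hx
  have hxm : ∀ i, Measurable (x i) := fun i => measurable_discExcess Metric.diam_nonneg _
  have hmgf : ∀ i, NegDriftMGF (Measure.pi fun n => cellMeasure μ (P (a n))) (x i) (I i).card :=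
    fun i => by
      refine negDriftMGF_discExcess hm hC0 _ _ Metric.diam_nonneg ?_
      rcases (I i).eq_empty_or_nonempty with h0 | ⟨n, hn⟩
      · have hz : ∀ D, lipDisc (cellMeasure μ (P i)) (Metric.diam (P i)) (I i) D = 0 := fun D =>
          le_antisymm (by
            simpa [h0] using lipDisc_le (ν := cellMeasure μ (P i))
              (Metric.diam_nonneg (s := P i)) (I i) D)
            (lipDisc_nonneg Metric.diam_nonneg _ D)
        simp only [hz, integral_zero]
        have := Metric.diam_nonneg (s := P i)
        positivity
      · have hi0 : μ (P i) ≠ 0 := by rw [← (hI i n).1 hn]; exact ha n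
        refine integral_lipDisc_le hm (S := P i ∩ R) _ _ (fun n hn => ?_) Metric.diam_nonneg
          (fun x hx y hy => Metric.dist_le_diam_of_mem (hb i) hx.1 hy.1)
          (hK _ Set.inter_subset_right _ Metric.diam_nonneg
            fun x hx y hy => Metric.dist_le_diam_of_mem (hb i) hx.1 hy.1) ?_
        · rw [(hI i n).1 hn]
        · rw [cellMeasure, if_neg hi0]
          filter_upwards [ae_cond_mem (hP i), cond_absolutelyContinuous.ae_le hR] with z h1 h2
          exact ⟨h1, h2⟩
  have hprod : ∀ (A : Finset κ) (g : κ → ℝ → ℝ≥0∞), (∀ i, Measurable (g i)) →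
      ∫⁻ D, ∏ i ∈ A, g i (x i D) ∂Measure.pi (fun n => cellMeasure μ (P (a n))) =
        ∏ i ∈ A, ∫⁻ D, g i (x i D) ∂Measure.pi (fun n => cellMeasure μ (P (a n))) :=
    fun A g hg => by
      refine lintegral_prod_pi_of_dependsOn _ I (fun i j hij => ?_)
        (fun i D => g i (x i D)) (fun i => (hg i).comp (hxm i)) (fun i D D' h => ?_) A
      · refine Finset.disjoint_left.2 ?_
        exact fun n h1 h2 => hij (((hI i n).1 h1).symm.trans ((hI j n).1 h2))
      · simp only [hx, discExcess]
        rw [dependsOn_lipDisc (I i) h]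
  have hsum : ∑ i, ((I i).card : ℝ) ≤ N := by
    have : ∑ i, (I i).card = N := by
      have h1 := Finset.card_eq_sum_card_fiberwise (f := a) (s := Finset.univ) (t := Finset.univ)
        (fun _ _ => Finset.mem_coe.2 (Finset.mem_univ _))
      rw [Finset.card_univ, Fintype.card_fin] at h1
      conv_rhs => rw [h1]
      refine Finset.sum_congr rfl fun i _ => congrArg _ (Finset.ext fun n => ?_)
      simp [hI]
    exact_mod_cast this.le
  refine (measure_union_le _ _).trans ?_
  rw [two_mul, ENNReal.ofReal_add (by positivity) (by positivity)]
  exact add_le_add (meas_sum_posPart_gt_le hxm _ hmgf hprod hs hsum)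
    (meas_sum_indicator_gt_le hxm _ hmgf hprod hs hst (Nat.cast_nonneg N) hk)

/-- Hoeffding for each union of cells and a union bound over the `2^k` unions. The exponent `k ln 2
- 2 N (4 t / 5)²` is at most `(0.7 - 1.28) N t²`, and `t² ≥ 2 s²`. -/
theorem pi_measure_bad_freq_le {N : ℕ} (hN : 0 < N) (μ : Measure E) [IsProbabilityMeasure μ]
    (P : κ → Set E) (hP : ∀ i, MeasurableSet (P i))
    (hdisj : Pairwise fun i j => Disjoint (P i) (P j))
    {s t : ℝ} (ht : 0 ≤ t) (hst : 2 * s ^ 2 ≤ t ^ 2) (hk : Fintype.card κ ≤ t ^ 2 * N) :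
    Measure.pi (fun _ : Fin N => μ) {D | ¬ ∀ S : Finset κ,
      ∑ i ∈ S, (μ.real (P i) - (cellIndices P D i).card / N) ≤ 4 / 5 * t} ≤
      ENNReal.ofReal (Real.exp (-(N * s ^ 2))) := by
  classical
  have hN' : (0 : ℝ) < N := by exact_mod_cast hN
  have hsub : {D : Fin N → E | ¬ ∀ S : Finset κ,
      ∑ i ∈ S, (μ.real (P i) - (cellIndices P D i).card / N) ≤ 4 / 5 * t} ⊆
      ⋃ S : Finset κ, {D | N * (4 / 5 * t) ≤
        ∑ n, (μ.real (⋃ i ∈ S, P i) - (⋃ i ∈ S, P i).indicator 1 (D n))} := fun D hD => by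
    obtain ⟨S, hS⟩ := not_forall.1 (show ¬ _ from hD)
    refine Set.mem_iUnion.2 ⟨S, ?_⟩
    have h1 : μ.real (⋃ i ∈ S, P i) = ∑ i ∈ S, μ.real (P i) :=
      measureReal_biUnion_finset (fun i _ j _ hij => hdisj hij) fun i _ => hP i
    have h2 : ∀ z, (⋃ i ∈ S, P i).indicator (1 : E → ℝ) z = ∑ i ∈ S, (P i).indicator 1 z :=
      fun z => by
        exact Finset.indicator_biUnion_apply S P (fun i _ j _ hij => hdisj hij) z
    have h3 : ∀ i, ∑ n, (P i).indicator (1 : E → ℝ) (D n) = (cellIndices P D i).card := fun i => by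
      simp [cellIndices, Set.indicator_apply]
    have h4 : ∑ n, (μ.real (⋃ i ∈ S, P i) - (⋃ i ∈ S, P i).indicator 1 (D n)) =
        N * ∑ i ∈ S, (μ.real (P i) - (cellIndices P D i).card / N) := by
      rw [Finset.sum_sub_distrib, h1]
      simp_rw [h2]
      have h5 : ∑ n, ∑ i ∈ S, (P i).indicator (1 : E → ℝ) (D n) =
          ∑ i ∈ S, ((cellIndices P D i).card : ℝ) := by
        rw [Finset.sum_comm]
        exact Finset.sum_congr rfl fun i _ => h3 i
      rw [h5]
      simp only [mul_sub, Finset.sum_sub_distrib, Finset.sum_const, Finset.card_univ,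
        Fintype.card_fin, nsmul_eq_mul, Finset.mul_sum]
      congr 1
      exact Finset.sum_congr rfl fun i _ => by field_simp
    show N * (4 / 5 * t) ≤ _
    rw [h4]
    exact mul_le_mul_of_nonneg_left (not_le.1 hS).le hN'.le
  calc _ ≤ ∑ S : Finset κ, Measure.pi (fun _ : Fin N => μ) {D | N * (4 / 5 * t) ≤
        ∑ n, (μ.real (⋃ i ∈ S, P i) - (⋃ i ∈ S, P i).indicator 1 (D n))} :=
        (measure_mono hsub).trans (measure_iUnion_fintype_le _ _)
    _ ≤ ∑ _S : Finset κ, ENNReal.ofReal (Real.exp (-(2 * N * (4 / 5 * t) ^ 2))) :=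
        Finset.sum_le_sum fun S _ => pi_measure_hoeffding_le hN μ
          (S.measurableSet_biUnion fun i _ => hP i) (by positivity)
    _ = ENNReal.ofReal (2 ^ Fintype.card κ * Real.exp (-(2 * N * (4 / 5 * t) ^ 2))) := by
        rw [Finset.sum_const, Finset.card_univ, Fintype.card_finset, nsmul_eq_mul,
          ENNReal.ofReal_mul (by positivity)]
        congr 1
        rw [ENNReal.ofReal_pow zero_le_two]
        simp
    _ ≤ ENNReal.ofReal (Real.exp (-(N * s ^ 2))) := by
        refine ENNReal.ofReal_le_ofReal ?_
        have h2 : (2 : ℝ) ^ Fintype.card κ = Real.exp (Fintype.card κ * Real.log 2) := by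
          rw [mul_comm, Real.exp_mul, Real.exp_log two_pos, Real.rpow_natCast]
        rw [h2, ← Real.exp_add, Real.exp_le_exp]
        have hl := Real.log_two_lt_d9
        have hl0 := Real.log_pos one_lt_two
        have h5 : (Fintype.card κ : ℝ) * Real.log 2 ≤ t ^ 2 * N * 0.7 := by
          have : (0 : ℝ) ≤ t ^ 2 * N := by positivity
          calc (Fintype.card κ : ℝ) * Real.log 2 ≤ t ^ 2 * N * Real.log 2 := by gcongr
            _ ≤ t ^ 2 * N * 0.7 := by gcongr; linarith
        have h6 : 0 ≤ N * (t ^ 2 - 2 * s ^ 2) := mul_nonneg hN'.le (by linarith)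
        have h7 : 0 ≤ N * s ^ 2 := by positivity
        nlinarith

theorem pi_measure_not_goodSample_le {N m : ℕ} (hN : 0 < N) (hm : 3 ≤ m) {K : ℝ} {R : Set E}
    (hK : ∀ S ⊆ R, ∀ d : ℝ, 0 ≤ d → (∀ x ∈ S, ∀ y ∈ S, dist x y ≤ d) →
      ∀ j : ℕ, ∃ T : Finset E, ↑T ⊆ S ∧ (T.card : ℝ) ≤ K * 2 ^ (j * m) ∧
        ∀ x ∈ S, ∃ y ∈ T, dist x y ≤ d / 2 ^ j)
    (μ : Measure E) [IsProbabilityMeasure μ] (hR : ∀ᵐ z ∂μ, z ∈ R)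
    (P : κ → Set E) (hP : ∀ i, MeasurableSet (P i)) (hb : ∀ i, Bornology.IsBounded (P i))
    (hdisj : Pairwise fun i j => Disjoint (P i) (P j)) (hU : ∀ᵐ z ∂μ, z ∈ ⋃ i, P i)
    {s t : ℝ} (hs : 0 ≤ s) (ht : 0 ≤ t) (hst : 2 * s ^ 2 ≤ t ^ 2)
    (hk : Fintype.card κ ≤ t ^ 2 * N) (hk' : Fintype.card κ ≤ t * N) :
    Measure.pi (fun _ : Fin N => μ)
      {D | ¬ GoodSample μ P m (4 + 5 * √(K * 2 ^ m) + 3) s t D} ≤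
      ENNReal.ofReal (3 * Real.exp (-(N * s ^ 2))) := by
  classical
  set C : ℝ := 4 + 5 * √(K * 2 ^ m) + 3 with hC
  have hst' : s ≤ t := by nlinarith
  set B1 : Set (Fin N → E) := {D | N * s < ∑ i with 1 < 10 * s * (cellIndices P D i).card,
      max (discExcess m C (cellMeasure μ (P i)) (Metric.diam (P i)) (cellIndices P D i) D) 0} ∪
    {D | t * N / 5 < ∑ i with ¬ 1 < 10 * s * (cellIndices P D i).card,
      ((cellIndices P D i).card : ℝ) *
      (if 0 < discExcess m C (cellMeasure μ (P i)) (Metric.diam (P i)) (cellIndices P D i) D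
        then (1 : ℝ) else 0)} with hB1
  have h1 : Measure.pi (fun _ : Fin N => μ) B1 ≤
      ENNReal.ofReal (2 * Real.exp (-(N * s ^ 2))) := by
    -- The index sets in `B1` depend on the sample, but on the box of `a` they equal `{n | a n =
    -- i}`.
    refine pi_measure_le_of_forall_assignment μ P hP hdisj hU B1 _ fun a ha => ?_
    refine ⟨_, fun D hD hDa => ?_, pi_measure_bad_cells_le hm hK μ hR P hP hb a ha
      (fun i => {n | a n = i}) (fun i n => by simp) hs hst' hk'⟩
    have hI : ∀ i, cellIndices P D i = ({n | a n = i} : Finset (Fin N)) := fun i => by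
      ext n
      simp only [cellIndices, Finset.mem_filter, Finset.mem_univ, true_and]
      refine ⟨fun h => ?_, fun h => h ▸ hDa n⟩
      by_contra hne
      exact Set.disjoint_left.1 (hdisj hne) (hDa n) h
    rw [hB1] at hD
    simp only [hI, Set.mem_union, Set.mem_ofPred_eq] at hD
    exact hD
  have h2 := pi_measure_bad_freq_le hN μ P hP hdisj ht hst hk
  have hsub : {D | ¬ GoodSample μ P m C s t D} ⊆ B1 ∪ {D | ¬ ∀ S : Finset κ,
      ∑ i ∈ S, (μ.real (P i) - (cellIndices P D i).card / N) ≤ 4 / 5 * t} := fun D hD => by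
    by_contra hcon
    rw [hB1, Set.mem_union, Set.mem_union, not_or, not_or] at hcon
    exact hD ⟨not_lt.1 hcon.1.1, not_lt.1 hcon.1.2, not_not.1 hcon.2⟩
  refine (measure_mono hsub).trans ((measure_union_le _ _).trans ((add_le_add h1 h2).trans ?_))
  rw [← ENNReal.ofReal_add (by positivity) (by positivity)]
  exact ENNReal.ofReal_le_ofReal (by linarith)

end Good

/-! ### Mean minus sample mean in terms of discrepancies. -/

theorem exists_mem_lipClass_eqOn {E : Type*} [MetricSpace E] {A : Set E}
    (hA : Bornology.IsBounded A) {g : E → ℝ} {Λ : ℝ} (hΛ : 0 < Λ)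
    (hg : ∀ z ∈ A, ∀ z' ∈ A, |g z - g z'| ≤ Λ * dist z z') :
    ∃ h ∈ lipClass E (Metric.diam A), ∃ c : ℝ, ∀ z ∈ A, g z = Λ * h z + c := by
  have hd := Metric.diam_nonneg (s := A)
  rcases A.eq_empty_or_nonempty with rfl | ⟨p, hp⟩
  · exact ⟨_, zero_mem_lipClass hd, 0, by simp⟩
  have hbdd : BddBelow ((fun z => g z / Λ) '' A) := by
    refine ⟨g p / Λ - Metric.diam A, ?_⟩
    rintro _ ⟨z, hz, rfl⟩
    have h1 := (abs_le.1 (hg p hp z hz)).2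
    have h2 := mul_le_mul_of_nonneg_left (Metric.dist_le_diam_of_mem hA hp hz) hΛ.le
    have h3 : (g p - g z) / Λ ≤ Metric.diam A := by
      rw [div_le_iff₀ hΛ]; linarith
    rw [sub_div] at h3
    simp only
    linarith
  set c := sInf ((fun z => g z / Λ) '' A) with hc
  have hlip : LipschitzOnWith 1 (fun z => g z / Λ - c) A :=
    LipschitzOnWith.of_dist_le_mul fun z hz z' hz' => by
      rw [Real.dist_eq, sub_sub_sub_cancel_right, ← sub_div, abs_div, abs_of_pos hΛ,
        div_le_iff₀ hΛ, NNReal.coe_one, one_mul, mul_comm]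
      exact hg z hz z' hz'
  -- Rescaled and shifted to infimum `0`, the function takes values in `[0, diam A]` on `A`. It is
  -- extended to the whole space, and clipping restores the range without changing it on `A`.
  obtain ⟨G, hG, hGA⟩ := hlip.extend_real
  have hrange : ∀ z ∈ A, g z / Λ - c ∈ Set.Icc 0 (Metric.diam A) := fun z hz => by
    refine ⟨sub_nonneg.2 (csInf_le hbdd ⟨z, hz, rfl⟩), ?_⟩
    rw [sub_le_comm]
    refine le_csInf ⟨_, p, hp, rfl⟩ ?_
    rintro _ ⟨z', hz', rfl⟩
    have h1 := (abs_le.1 (hg z hz z' hz')).2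
    have h2 := mul_le_mul_of_nonneg_left (Metric.dist_le_diam_of_mem hA hz hz') hΛ.le
    have h3 : (g z - g z') / Λ ≤ Metric.diam A := by
      rw [div_le_iff₀ hΛ]; linarith
    rw [sub_div] at h3
    simp only
    linarith
  refine ⟨fun z => max 0 (min (Metric.diam A) (G z)), ⟨(hG.const_min _).const_max _, fun z =>
    ⟨le_max_left _ _, max_le hd (min_le_left _ _)⟩⟩, Λ * c, fun z hz => ?_⟩
  have hGz : g z / Λ - c = G z := hGA hz
  simp only
  rw [← hGz, min_eq_right (hrange z hz).2, max_eq_right (hrange z hz).1]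
  field_simp
  ring

section Decomposition

variable {E κ : Type*} [MetricSpace E] [MeasurableSpace E] [BorelSpace E] [Fintype κ]

theorem setIntegral_eq_mul_integral_cellMeasure {μ : Measure E} [IsProbabilityMeasure μ]
    {A : Set E} (h0 : μ A ≠ 0) (g : E → ℝ) :
    ∫ z in A, g z ∂μ = μ.real A * ∫ z, g z ∂cellMeasure μ A := by
  rw [cellMeasure, if_neg h0, ProbabilityTheory.cond, integral_smul_measure, smul_eq_mul,
    ← mul_assoc, ENNReal.toReal_inv, measureReal_def, mul_inv_cancel₀, one_mul]
  exact ENNReal.toReal_ne_zero.2 ⟨h0, measure_ne_top _ _⟩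

/-- As the weights sum to zero, the values may be shifted to `[0, B]`; the worst case then puts `B`
on the positive weights, so only the range of the values counts. -/
theorem sum_mul_le_of_sum_le {b v : κ → ℝ} (hb : ∑ i, b i = 0) {β B τ : ℝ} (hB : 0 ≤ B)
    (hv : ∀ i, v i ∈ Set.Icc β (β + B)) (hτ : ∀ S : Finset κ, ∑ i ∈ S, b i ≤ τ) :
    ∑ i, b i * v i ≤ B * τ := by
  classical
  calc ∑ i, b i * v i = ∑ i, b i * (v i - β) := by
        simp only [mul_sub, Finset.sum_sub_distrib, ← Finset.sum_mul, hb]; ring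
    _ ≤ ∑ i, if 0 < b i then b i * B else 0 := by
        refine Finset.sum_le_sum fun i _ => ?_
        have h1 := (hv i).1
        have h2 := (hv i).2
        split_ifs with h
        · exact mul_le_mul_of_nonneg_left (by linarith) h.le
        · exact mul_nonpos_of_nonpos_of_nonneg (not_lt.1 h) (by linarith)
    _ = B * ∑ i with 0 < b i, b i := by
        rw [← Finset.sum_filter, Finset.mul_sum]
        exact Finset.sum_congr rfl fun i _ => mul_comm _ _
    _ ≤ B * τ := mul_le_mul_of_nonneg_left (hτ _) hB

theorem sum_cellIndices {N : ℕ} {P : κ → Set E} (hdisj : Pairwise fun i j => Disjoint (P i) (P j))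
    {D : Fin N → E} (hD : ∀ n, D n ∈ ⋃ i, P i) (φ : Fin N → ℝ) :
    ∑ n, φ n = ∑ i, ∑ n ∈ cellIndices P D i, φ n := by
  classical
  choose a ha using fun n => Set.mem_iUnion.1 (hD n)
  rw [← Finset.sum_fiberwise (s := Finset.univ) (g := a)]
  refine Finset.sum_congr rfl fun i _ => Finset.sum_congr (Finset.ext fun n => ?_) fun _ _ => rfl
  simp only [cellIndices, Finset.mem_filter, Finset.mem_univ, true_and]
  refine ⟨fun h => h ▸ ha n, fun h => ?_⟩
  by_contra hne
  exact Set.disjoint_left.1 (hdisj hne) (ha n) h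

/-- The difference between a mean and a sample mean in terms of the discrepancies in the cells. -/
theorem integral_sub_average_le {N m : ℕ} (hN : 0 < N) {μ : Measure E} [IsProbabilityMeasure μ]
    {P : κ → Set E} (hP : ∀ i, MeasurableSet (P i)) (hb : ∀ i, Bornology.IsBounded (P i))
    (hdisj : Pairwise fun i j => Disjoint (P i) (P j)) (hU : ∀ᵐ z ∂μ, z ∈ ⋃ i, P i)
    {D : Fin N → E} (hD : ∀ n, D n ∈ ⋃ i, P i) {g : E → ℝ} {β B : ℝ} (hB : 0 ≤ B)
    (hgB : ∀ z ∈ ⋃ i, P i, g z ∈ Set.Icc β (β + B)) {Λ : κ → ℝ} (hΛ : ∀ i, 0 < Λ i)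
    (hg : ∀ i, ∀ z ∈ P i, ∀ z' ∈ P i, |g z - g z'| ≤ Λ i * dist z z')
    {W : ℝ} (hW : ∀ i, Λ i * Metric.diam (P i) ≤ W) {C s u τ : ℝ} (hC : 0 ≤ C) (hW0 : 0 ≤ W)
    (hlarge : ∑ i with 1 < 10 * s * (cellIndices P D i).card,
      max (discExcess m C (cellMeasure μ (P i)) (Metric.diam (P i)) (cellIndices P D i) D) 0
        ≤ N * s)
    (hsmall : ∑ i with ¬ 1 < 10 * s * (cellIndices P D i).card, ((cellIndices P D i).card : ℝ) *
      (if 0 < discExcess m C (cellMeasure μ (P i)) (Metric.diam (P i)) (cellIndices P D i) D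
        then (1 : ℝ) else 0) ≤ u * N)
    (hfreq : ∀ S : Finset κ, ∑ i ∈ S, (μ.real (P i) - (cellIndices P D i).card / N) ≤ τ) :
    ∫ z, g z ∂μ - 1 / N * ∑ n, g (D n) ≤
      C / N * ∑ i, ((cellIndices P D i).card : ℝ) ^ (1 - 1 / (m : ℝ)) *
        (Λ i * Metric.diam (P i)) + W * s + B * (u + τ) := by
  classical
  have hN' : (0 : ℝ) < N := by exact_mod_cast hN
  choose h hh c hc using fun i => exists_mem_lipClass_eqOn (hb i) (hΛ i) (hg i)
  set I := cellIndices P D with hI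
  have hmemI : ∀ i, ∀ n ∈ I i, D n ∈ P i := fun i n hn => by
    simpa [hI, cellIndices] using hn
  set x : κ → ℝ := fun i => discExcess m C (cellMeasure μ (P i)) (Metric.diam (P i)) (I i) D
    with hx
  -- In a null cell the lower bound `β` serves as the mean: its weight is zero, and any sample
  -- points there contribute nonpositively.
  set M : κ → ℝ := fun i => if μ (P i) = 0 then β else ∫ z, g z ∂cellMeasure μ (P i) with hM
  have hae : ∀ i, μ (P i) ≠ 0 → ∀ᵐ z ∂cellMeasure μ (P i), z ∈ P i := fun i h0 => by
    rw [cellMeasure, if_neg h0]; exact ae_cond_mem (hP i)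
  have hmean : ∀ i, μ (P i) ≠ 0 → M i = Λ i * ∫ z, h i z ∂cellMeasure μ (P i) + c i :=
    fun i h0 => by
      simp only [hM, if_neg h0]
      rw [integral_congr_ae (g := fun z => Λ i * h i z + c i)
        ((hae i h0).mono fun z hz => hc i z hz), integral_add
        ((integrable_of_mem_lipClass (hh i)).const_mul _) (integrable_const _), integral_const_mul]
      simp
  have hMB : ∀ i, M i ∈ Set.Icc β (β + B) := fun i => by
    by_cases h0 : μ (P i) = 0
    · simp [hM, h0, hB]
    · have hgi : Integrable g (cellMeasure μ (P i)) :=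
        (((integrable_of_mem_lipClass (hh i)).const_mul (Λ i)).add (integrable_const (c i))).congr
          ((hae i h0).mono fun z hz => (hc i z hz).symm)
      simp only [hM, if_neg h0]
      constructor
      · calc β = ∫ _, β ∂cellMeasure μ (P i) := by simp
          _ ≤ _ := integral_mono_ae (integrable_const _) hgi
              ((hae i h0).mono fun z hz => (hgB z (Set.mem_iUnion.2 ⟨i, hz⟩)).1)
      · calc ∫ z, g z ∂cellMeasure μ (P i) ≤ ∫ _, (β + B) ∂cellMeasure μ (P i) :=
              integral_mono_ae hgi (integrable_const _)
                ((hae i h0).mono fun z hz => (hgB z (Set.mem_iUnion.2 ⟨i, hz⟩)).2)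
          _ = β + B := by simp
  have hint : ∫ z, g z ∂μ = ∑ i, μ.real (P i) * M i := by
    have hres : μ.restrict (⋃ i, P i) = μ := Measure.restrict_eq_self_of_ae_mem hU
    conv_lhs => rw [← hres]
    rw [integral_iUnion_fintype hP hdisj fun i => ?_]
    · refine Finset.sum_congr rfl fun i _ => ?_
      by_cases h0 : μ (P i) = 0
      · simp [measureReal_def, h0, Measure.restrict_eq_zero.2 h0]
      · rw [setIntegral_eq_mul_integral_cellMeasure h0]
        simp [hM, h0]
    · exact ((((integrable_of_mem_lipClass (hh i)).const_mul (Λ i)).add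
        (integrable_const (c i))).integrableOn).congr_fun (fun z hz => (hc i z hz).symm) (hP i)
  have hcell : ∀ i, ∑ n ∈ I i, (M i - g (D n)) ≤
      Λ i * lipDisc (cellMeasure μ (P i)) (Metric.diam (P i)) (I i) D := fun i => by
    have hnn := mul_nonneg (hΛ i).le (lipDisc_nonneg (ν := cellMeasure μ (P i))
      (Metric.diam_nonneg (s := P i)) (I i) D)
    by_cases h0 : μ (P i) = 0
    · refine le_trans (Finset.sum_nonpos fun n hn => ?_) hnn
      have := (hgB (D n) (hD n)).1
      simp only [hM, if_pos h0]
      linarith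
    · calc ∑ n ∈ I i, (M i - g (D n))
          = Λ i * ∑ n ∈ I i, (∫ z, h i z ∂cellMeasure μ (P i) - h i (D n)) := by
            rw [Finset.mul_sum]
            refine Finset.sum_congr rfl fun n hn => ?_
            rw [hmean i h0, hc i _ (hmemI i n hn)]
            ring
        _ ≤ _ := mul_le_mul_of_nonneg_left (le_lipDisc _ _ (hh i)) (hΛ i).le
  have hcellB : ∀ i, ∑ n ∈ I i, (M i - g (D n)) ≤ B * (I i).card := fun i => by
    calc ∑ n ∈ I i, (M i - g (D n)) ≤ ∑ n ∈ I i, B := Finset.sum_le_sum fun n _ => by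
          linarith [(hMB i).2, (hgB (D n) (hD n)).1]
      _ = _ := by simp [mul_comm]
  have hdiv : ∀ i, lipDisc (cellMeasure μ (P i)) (Metric.diam (P i)) (I i) D =
      Metric.diam (P i) * (x i + C * ((I i).card : ℝ) ^ (1 - 1 / (m : ℝ))) := fun i => by
    simp only [hx, discExcess, sub_add_cancel]
    rcases eq_or_ne (Metric.diam (P i)) 0 with hd | hd
    · rw [hd, zero_mul]
      exact le_antisymm (by simpa using lipDisc_le (ν := cellMeasure μ (P i)) le_rfl (I i) D)
        (lipDisc_nonneg le_rfl _ D)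
    · field_simp
  set tr : κ → ℝ := fun i => ((I i).card : ℝ) ^ (1 - 1 / (m : ℝ)) * (Λ i * Metric.diam (P i))
    with htr
  have hΛd : ∀ i, 0 ≤ Λ i * Metric.diam (P i) := fun i =>
    mul_nonneg (hΛ i).le Metric.diam_nonneg
  have htr0 : ∀ i, 0 ≤ C * tr i := fun i => by
    have := hΛd i
    simp only [htr]
    positivity
  -- A large cell pays its positive excess, weighted by `W`. A small cell pays nothing beyond the
  -- transport term unless the excess is positive, and then the trivial bound `B` per point.
  have hcell' : ∀ i, ∑ n ∈ I i, (M i - g (D n)) ≤ C * tr i +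
      ((if 1 < 10 * s * (I i).card then W * max (x i) 0 else 0) +
        if ¬ 1 < 10 * s * (I i).card then B * ((I i).card * if 0 < x i then 1 else 0) else 0) :=
    fun i => by
      have h1 := hcell i
      rw [hdiv i] at h1
      have e1 : Λ i * (Metric.diam (P i) * (x i + C * ((I i).card : ℝ) ^ (1 - 1 / (m : ℝ)))) =
          C * tr i + Λ i * Metric.diam (P i) * x i := by simp only [htr]; ring
      rw [e1] at h1
      have h2 : Λ i * Metric.diam (P i) * x i ≤ W * max (x i) 0 :=
        (mul_le_mul_of_nonneg_left (le_max_left _ _) (hΛd i)).trans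
          (mul_le_mul_of_nonneg_right (hW i) (le_max_right _ _))
      by_cases hl : 1 < 10 * s * (I i).card
      · simp only [hl, if_true, not_true_eq_false, if_false]
        linarith
      · simp only [hl, if_false, not_false_eq_true, if_true]
        by_cases hxi : 0 < x i
        · simp only [hxi, if_true]
          linarith [hcellB i, htr0 i]
        · simp only [hxi, if_false]
          have := mul_nonpos_of_nonneg_of_nonpos (hΛd i) (not_lt.1 hxi)
          linarith
  have hcard : ∑ i, ((I i).card : ℝ) = N := by
    have := sum_cellIndices hdisj hD fun _ => (1 : ℝ)
    simpa using this.symm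
  have hprob : ∑ i, μ.real (P i) = 1 := by
    have h1 := measureReal_iUnion_fintype (μ := μ) hdisj hP
    rw [← h1, measureReal_def, (prob_compl_eq_zero_iff (MeasurableSet.iUnion hP)).1 hU]
    rfl
  have hfirst : ∑ i, (μ.real (P i) - (I i).card / N) * M i ≤ B * τ :=
    sum_mul_le_of_sum_le (by
      rw [Finset.sum_sub_distrib, hprob, ← Finset.sum_div, hcard, div_self hN'.ne', sub_self])
      hB hMB hfreq
  have hsecond : ∑ i, ∑ n ∈ I i, (M i - g (D n)) ≤
      C * ∑ i, tr i + (W * (N * s) + B * (u * N)) := by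
    refine (Finset.sum_le_sum fun i _ => hcell' i).trans ?_
    rw [Finset.sum_add_distrib, Finset.sum_add_distrib, ← Finset.sum_filter, ← Finset.sum_filter,
      ← Finset.mul_sum, ← Finset.mul_sum, ← Finset.mul_sum]
    gcongr
  have hsplit : ∫ z, g z ∂μ - 1 / N * ∑ n, g (D n) =
      ∑ i, (μ.real (P i) - (I i).card / N) * M i +
        1 / N * ∑ i, ∑ n ∈ I i, (M i - g (D n)) := by
    rw [hint, sum_cellIndices hdisj hD fun n => g (D n), Finset.mul_sum, Finset.mul_sum,
      ← Finset.sum_sub_distrib, ← Finset.sum_add_distrib]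
    refine Finset.sum_congr rfl fun i _ => ?_
    rw [Finset.sum_sub_distrib, Finset.sum_const, nsmul_eq_mul]
    ring
  rw [hsplit]
  have h3 : 1 / N * ∑ i, ∑ n ∈ I i, (M i - g (D n)) ≤
      1 / N * (C * ∑ i, tr i + (W * (N * s) + B * (u * N))) :=
    mul_le_mul_of_nonneg_left hsecond (by positivity)
  have h4 : 1 / N * (C * ∑ i, tr i + (W * (N * s) + B * (u * N))) =
      C / N * ∑ i, tr i + W * s + B * u := by field_simp; ring
  linarith

end Decomposition

/-! ### The risk of a Lipschitz predictor. -/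

theorem lipConst_mono {d : ℕ} (g : EuclideanSpace ℝ (Fin d) → ℝ)
    {S S' : Set (EuclideanSpace ℝ (Fin d))} (h : S ⊆ S') : lipConst g S ≤ lipConst g S' :=
  iSup₂_le fun x₁ h₁ => iSup₂_le fun x₂ h₂ => iSup_le fun hne =>
    (le_iSup_of_le x₁ <| le_iSup_of_le (h h₁) <| le_iSup_of_le x₂ <| le_iSup_of_le (h h₂) <|
      le_iSup_of_le hne le_rfl)

theorem abs_sub_le_lipConst_mul {d : ℕ} {g : EuclideanSpace ℝ (Fin d) → ℝ}
    {S : Set (EuclideanSpace ℝ (Fin d))} (hfin : lipConst g S ≠ ∞)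
    {x x' : EuclideanSpace ℝ (Fin d)} (hx : x ∈ S) (hx' : x' ∈ S) :
    |g x - g x'| ≤ (lipConst g S).toReal * dist x x' := by
  rcases eq_or_ne x x' with rfl | hne
  · simp
  have h1 : ENNReal.ofReal (|g x - g x'| / ‖x - x'‖) ≤ lipConst g S :=
    le_iSup_of_le x <| le_iSup_of_le hx <| le_iSup_of_le x' <| le_iSup_of_le hx' <|
      le_iSup_of_le hne le_rfl
  have h2 := (ENNReal.ofReal_le_iff_le_toReal hfin).1 h1
  rwa [div_le_iff₀ (norm_pos_iff.2 (sub_ne_zero.2 hne)), ← dist_eq_norm] at h2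

/-- The map `(x, y) ↦ (f x, y)` stretches Euclidean distances by at most `max{1, Lip}`, because both
squared components are stretched by at most its square. -/
theorem IsLipschitzLoss.abs_sub_le {d : ℕ} {ℓ : ℝ → ℝ → ℝ} {Y : Set ℝ} {L : ℝ} (hL : 0 < L)
    (hℓ : IsLipschitzLoss ℓ Y L) {X : Set (EuclideanSpace ℝ (Fin d))}
    {f : EuclideanSpace ℝ (Fin d) → ℝ} (hf : Set.MapsTo f X Y) (hfin : lipConst f X ≠ ∞)
    {A : Set (DataSpace d)} (hA : A ⊆ dataDomain X Y) {z z' : DataSpace d} (hz : z ∈ A)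
    (hz' : z' ∈ A) :
    |ℓ (f z.fst) z.snd - ℓ (f z'.fst) z'.snd| ≤
      L * max 1 (lipConst f ((fun z : DataSpace d => z.fst) '' A)).toReal * dist z z' := by
  have hsub : (fun z : DataSpace d => z.fst) '' A ⊆ X := by
    rintro _ ⟨w, hw, rfl⟩
    exact (hA hw).1
  have hfin' := ne_top_of_le_ne_top hfin (lipConst_mono f hsub)
  set a := max 1 (lipConst f ((fun z : DataSpace d => z.fst) '' A)).toReal with ha
  have ha1 : 1 ≤ a := le_max_left _ _
  have h1 : |f z.fst - f z'.fst| ≤ a * dist z.fst z'.fst :=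
    (abs_sub_le_lipConst_mul hfin' ⟨z, hz, rfl⟩ ⟨z', hz', rfl⟩).trans
      (mul_le_mul_of_nonneg_right (le_max_right _ _) dist_nonneg)
  have h2 : |z.snd - z'.snd| ≤ a * dist z.snd z'.snd := by
    rw [← Real.dist_eq]
    exact le_mul_of_one_le_left dist_nonneg ha1
  have h3 : √((f z.fst - f z'.fst) ^ 2 + (z.snd - z'.snd) ^ 2) ≤ a * dist z z' := by
    rw [WithLp.prod_dist_eq_of_L2]
    refine Real.sqrt_le_iff.2 ⟨by positivity, ?_⟩
    rw [mul_pow, Real.sq_sqrt (by positivity), mul_add, ← mul_pow, ← mul_pow,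
      ← sq_abs (f z.fst - f z'.fst), ← sq_abs (z.snd - z'.snd)]
    gcongr
  calc |ℓ (f z.fst) z.snd - ℓ (f z'.fst) z'.snd|
      ≤ L * √((f z.fst - f z'.fst) ^ 2 + (z.snd - z'.snd) ^ 2) :=
        hℓ _ (hf (hA hz).1) _ (hA hz).2 _ (hf (hA hz').1) _ (hA hz').2
    _ ≤ L * (a * dist z z') := by gcongr
    _ = _ := by ring

theorem isBounded_dataDomain {d : ℕ} {X : Set (EuclideanSpace ℝ (Fin d))} {Y : Set ℝ}
    (hX : IsCompact X) (hY : IsCompact Y) : Bornology.IsBounded (dataDomain X Y) := by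
  obtain ⟨a, ha⟩ := Metric.isBounded_iff.1 hX.isBounded
  obtain ⟨b, hb⟩ := Metric.isBounded_iff.1 hY.isBounded
  refine Metric.isBounded_iff.2 ⟨√(a ^ 2 + b ^ 2), fun z hz w hw => ?_⟩
  rw [WithLp.prod_dist_eq_of_L2]
  have h1 := ha hz.1 hw.1
  have h2 := hb hz.2 hw.2
  gcongr

/-- A Lipschitz loss is bounded on the bounded square, so the `sSup` is a genuine supremum and not
the default `0`. -/
theorem abs_le_lossSupNorm {ℓ : ℝ → ℝ → ℝ} {Y : Set ℝ} (hY : IsCompact Y) {L : ℝ} (hL : 0 < L)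
    (hℓ : IsLipschitzLoss ℓ Y L) {a b : ℝ} (ha : a ∈ Y) (hb : b ∈ Y) :
    |ℓ a b| ≤ lossSupNorm ℓ Y := by
  obtain ⟨r, hr⟩ := Metric.isBounded_iff.1 hY.isBounded
  refine le_csSup ⟨|ℓ a b| + L * √(r ^ 2 + r ^ 2), ?_⟩ ⟨(a, b), ⟨ha, hb⟩, rfl⟩
  rintro _ ⟨⟨p, q⟩, ⟨hp, hq⟩, rfl⟩
  have h1 := hℓ p hp q hq a ha b hb
  have h2 : √((p - a) ^ 2 + (q - b) ^ 2) ≤ √(r ^ 2 + r ^ 2) := by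
    have h3 := hr hp ha
    have h4 := hr hq hb
    rw [Real.dist_eq] at h3 h4
    rw [← sq_abs (p - a), ← sq_abs (q - b)]
    gcongr
  have h5 := mul_le_mul_of_nonneg_left h2 hL.le
  have h6 := abs_sub_abs_le_abs_sub (ℓ p q) (ℓ a b)
  simp only
  linarith

theorem partitionCost_two_mul (N k : ℕ) (B δ : ℝ) :
    partitionCost N k (2 * B) δ = 2 * partitionCost N k B δ := by
  unfold partitionCost
  split_ifs <;> ring

theorem one_lt_log_four_div {δ : ℝ} (h0 : 0 < δ) (h1 : δ ≤ 1) : 1 < Real.log (4 / δ) := by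
  rw [Real.lt_log_iff_exp_lt (by positivity)]
  have : 4 ≤ 4 / δ := by rw [le_div_iff₀ h0]; linarith
  linarith [Real.exp_one_lt_d9]

section Risk

variable {d m N k : ℕ} {X : Set (EuclideanSpace ℝ (Fin d))} {Y : Set ℝ} {ℓ : ℝ → ℝ → ℝ}
  {Lℓ Lf δ : ℝ} {μ : Measure (DataSpace d)} [IsProbabilityMeasure μ]
  {P : Fin k → Set (DataSpace d)} {f : EuclideanSpace ℝ (Fin d) → ℝ} {D : Fin N → DataSpace d}

theorem risk_gap_le_of_discrepancy (hX : IsCompact X) (hY : IsCompact Y) (hLℓ : 0 < Lℓ)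
    (hLf : 0 < Lf) (hℓ : IsLipschitzLoss ℓ Y Lℓ) (hμ : ∀ᵐ z ∂μ, z ∈ dataDomain X Y)
    (hN : 0 < N) (hP : IsPartitioning P (dataDomain X Y)) (hf : Set.MapsTo f X Y)
    (hfL : lipConst f X ≤ ENNReal.ofReal Lf) (hD : ∀ n, D n ∈ dataDomain X Y) {β B : ℝ}
    (hB : 0 ≤ B) (hℓB : ∀ a ∈ Y, ∀ b ∈ Y, ℓ a b ∈ Set.Icc β (β + B)) {C u τ : ℝ} (hC : 0 ≤ C)
    (hlarge : ∑ i with 1 < 10 * √(Real.log (4 / δ) / N) * (cellIndices P D i).card,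
      max (discExcess m C (cellMeasure μ (P i)) (Metric.diam (P i)) (cellIndices P D i) D) 0
        ≤ N * √(Real.log (4 / δ) / N))
    (hsmall : ∑ i with ¬ 1 < 10 * √(Real.log (4 / δ) / N) * (cellIndices P D i).card,
      ((cellIndices P D i).card : ℝ) *
      (if 0 < discExcess m C (cellMeasure μ (P i)) (Metric.diam (P i)) (cellIndices P D i) D
        then (1 : ℝ) else 0) ≤ u * N)
    (hfreq : ∀ S : Finset (Fin k),
      ∑ i ∈ S, (μ.real (P i) - (cellIndices P D i).card / N) ≤ τ) :
    expectedRisk ℓ f μ - empiricalRisk ℓ f D ≤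
      transportCost C Lℓ m f D P + transportErr N Lℓ Lf δ P + B * (u + τ) := by
  have hsub : ∀ i, P i ⊆ dataDomain X Y := fun i => by
    rw [← hP.iUnion_eq]; exact Set.subset_iUnion P i
  have hfin : lipConst f X ≠ ∞ := ne_top_of_le_ne_top ENNReal.ofReal_ne_top hfL
  set Λ : Fin k → ℝ := fun i =>
    Lℓ * max 1 (lipConst f ((fun z : DataSpace d => z.fst) '' P i)).toReal with hΛ
  have hLip : ∀ i, (lipConst f ((fun z : DataSpace d => z.fst) '' P i)).toReal ≤ Lf := fun i => by
    refine ENNReal.toReal_le_of_le_ofReal hLf.le ((lipConst_mono f ?_).trans hfL)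
    rintro _ ⟨w, hw, rfl⟩
    exact (hsub i hw).1
  have hdiam : ∀ i, Metric.diam (P i) ≤ ⨆ i, Metric.diam (P i) := fun i =>
    le_ciSup (Set.finite_range fun i => Metric.diam (P i)).bddAbove i
  have hsup : 0 ≤ ⨆ i, Metric.diam (P i) := Real.iSup_nonneg fun i => Metric.diam_nonneg
  have key := integral_sub_average_le (m := m) hN hP.measurableSet
    (fun i => (isBounded_dataDomain hX hY).subset (hsub i)) (fun i j hij => hP.disjoint i j hij)
    (by rw [hP.iUnion_eq]; exact hμ) (D := D) (by rw [hP.iUnion_eq]; exact hD)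
    (g := fun z => ℓ (f z.fst) z.snd) hB
    (fun z hz => by
      rw [hP.iUnion_eq] at hz
      exact hℓB _ (hf hz.1) _ hz.2) (Λ := Λ) (fun i => by positivity)
    (fun i z hz z' hz' => hℓ.abs_sub_le hLℓ hf hfin (hsub i) hz hz')
    (W := Lℓ * max 1 Lf * ⨆ i, Metric.diam (P i)) (fun i => by
      simp only [hΛ]
      have := hLip i
      have := hdiam i
      gcongr) hC (by positivity) hlarge hsmall hfreq
  refine key.trans (le_of_eq ?_)
  congr 1
  congr 1
  · rw [transportCost, Finset.mul_sum, Finset.mul_sum]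
    refine Finset.sum_congr rfl fun i _ => ?_
    simp only [hΛ]
    have : sampleCount D (P i) = (cellIndices P D i).card := rfl
    rw [this]
    ring
  · rw [transportErr]; ring

theorem transportCost_nonneg {C : ℝ} (hC : 0 ≤ C) (hLℓ : 0 ≤ Lℓ) :
    0 ≤ transportCost C Lℓ m f D P := by
  have h : ∀ i, 0 ≤ Metric.diam (P i) := fun i => Metric.diam_nonneg
  unfold transportCost
  refine mul_nonneg (by positivity) (Finset.sum_nonneg fun i _ => ?_)
  have := h i
  positivity

theorem transportErr_nonneg (hLℓ : 0 ≤ Lℓ) : 0 ≤ transportErr N Lℓ Lf δ P := by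
  have : 0 ≤ ⨆ i, Metric.diam (P i) := Real.iSup_nonneg fun i => Metric.diam_nonneg
  unfold transportErr
  positivity

/-- The predictor is controlled only on `X`, but almost everywhere the integrand agrees with an
affine function of a bounded Lipschitz function. -/
theorem integrable_loss (hX : IsCompact X) (hY : IsCompact Y) (hLℓ : 0 < Lℓ)
    (hℓ : IsLipschitzLoss ℓ Y Lℓ) (hμ : ∀ᵐ z ∂μ, z ∈ dataDomain X Y) (hf : Set.MapsTo f X Y)
    (hfin : lipConst f X ≠ ∞) : Integrable (fun z : DataSpace d => ℓ (f z.fst) z.snd) μ := by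
  obtain ⟨h, hh, c, hc⟩ := exists_mem_lipClass_eqOn (isBounded_dataDomain hX hY)
    (g := fun z => ℓ (f z.fst) z.snd)
    (Λ := Lℓ * max 1 (lipConst f ((fun z : DataSpace d => z.fst) '' dataDomain X Y)).toReal)
    (by positivity) (fun z hz z' hz' => hℓ.abs_sub_le hLℓ hf hfin subset_rfl hz hz')
  exact (((integrable_of_mem_lipClass hh).const_mul _).add (integrable_const c)).congr
    (hμ.mono fun z hz => (hc z hz).symm)

theorem risk_gap_le_range (hX : IsCompact X) (hY : IsCompact Y) (hLℓ : 0 < Lℓ)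
    (hℓ : IsLipschitzLoss ℓ Y Lℓ) (hμ : ∀ᵐ z ∂μ, z ∈ dataDomain X Y) (hN : 0 < N)
    (hf : Set.MapsTo f X Y) (hfin : lipConst f X ≠ ∞) (hD : ∀ n, D n ∈ dataDomain X Y) {β B : ℝ}
    (hℓB : ∀ a ∈ Y, ∀ b ∈ Y, ℓ a b ∈ Set.Icc β (β + B)) :
    expectedRisk ℓ f μ - empiricalRisk ℓ f D ≤ B := by
  have hint := integrable_loss hX hY hLℓ hℓ hμ hf hfin
  have hN' : (0 : ℝ) < N := by exact_mod_cast hN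
  have h1 : expectedRisk ℓ f μ ≤ β + B := by
    calc expectedRisk ℓ f μ ≤ ∫ _, (β + B) ∂μ :=
          integral_mono_ae hint (integrable_const _)
            (hμ.mono fun z hz => (hℓB _ (hf hz.1) _ hz.2).2)
      _ = β + B := by simp
  have h2 : β ≤ empiricalRisk ℓ f D := by
    rw [empiricalRisk, one_div, ← div_eq_inv_mul, le_div_iff₀ hN']
    calc β * N = ∑ _n : Fin N, β := by simp [mul_comm]
      _ ≤ _ := Finset.sum_le_sum fun n _ => (hℓB _ (hf (hD n).1) _ (hD n).2).1
  linarith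

theorem risk_gap_le_of_goodSample (hX : IsCompact X) (hY : IsCompact Y) (hLℓ : 0 < Lℓ)
    (hLf : 0 < Lf) (hℓ : IsLipschitzLoss ℓ Y Lℓ) (hμ : ∀ᵐ z ∂μ, z ∈ dataDomain X Y)
    (hN : 0 < N) (hδ0 : 0 < δ) (hδ1 : δ ≤ 1) (hP : IsPartitioning P (dataDomain X Y))
    (hf : Set.MapsTo f X Y) (hfL : lipConst f X ≤ ENNReal.ofReal Lf)
    (hD : ∀ n, D n ∈ dataDomain X Y) {β B : ℝ} (hB : 0 ≤ B)
    (hℓB : ∀ a ∈ Y, ∀ b ∈ Y, ℓ a b ∈ Set.Icc β (β + B)) {C : ℝ} (hC : 0 ≤ C)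
    (hgood : GoodSample μ P m C √(Real.log (4 / δ) / N)
      (max √(2 * Real.log (4 / δ) / N) √((k : ℝ) / N)) D) :
    expectedRisk ℓ f μ - empiricalRisk ℓ f D ≤
      transportCost C Lℓ m f D P + transportErr N Lℓ Lf δ P + partitionCost N k B δ := by
  have hN' : (0 : ℝ) < N := by exact_mod_cast hN
  rcases lt_or_ge 1 k with hk | hk
  -- The shares `1/5` from the small cells and `4/5` from the frequencies make up the partition
  -- cost.
  · set t := max √(2 * Real.log (4 / δ) / N) √((k : ℝ) / N) with ht
    have h := risk_gap_le_of_discrepancy hX hY hLℓ hLf hℓ hμ hN hP hf hfL hD hB hℓB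
      (u := t / 5) (τ := 4 / 5 * t) hC hgood.large (by
        have := hgood.small
        rwa [div_mul_eq_mul_div]) hgood.freq
    rw [partitionCost, if_pos hk]
    have e : t / 5 + 4 / 5 * t = t := by ring
    rwa [e] at h
  -- With one cell the frequency is exact, and that cell is large since `ln(4/δ) > 1` gives `s ≥ 1 /
  -- N`; both parts of the partition cost vanish.
  · have hall : ∀ n, D n ∈ ⋃ i, P i := fun n => by rw [hP.iUnion_eq]; exact hD n
    have hcard : ∀ i, (cellIndices P D i).card = N := fun i => by
      have : cellIndices P D i = Finset.univ := by
        ext n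
        obtain ⟨j, hj⟩ := Set.mem_iUnion.1 (hall n)
        have hij : i = j := Fin.ext (by have := i.2; have := j.2; omega)
        simpa [cellIndices, hij] using hj
      rw [this, Finset.card_univ, Fintype.card_fin]
    have hη := one_lt_log_four_div hδ0 hδ1
    have hs : 1 < 10 * √(Real.log (4 / δ) / N) * N := by
      have h1 : √(1 / (N : ℝ) ^ 2) ≤ √(Real.log (4 / δ) / N) := by
        refine Real.sqrt_le_sqrt ?_
        have hN1 : (1 : ℝ) ≤ N := by exact_mod_cast hN
        rw [div_le_div_iff₀ (by positivity) hN']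
        nlinarith
      rw [Real.sqrt_div zero_le_one, Real.sqrt_one, Real.sqrt_sq hN'.le,
        div_le_iff₀ hN'] at h1
      nlinarith
    have h := risk_gap_le_of_discrepancy hX hY hLℓ hLf hℓ hμ hN hP hf hfL hD hB hℓB
      (u := 0) (τ := 0) hC hgood.large (by
        rw [Finset.sum_eq_zero, zero_mul]
        intro i hi
        rw [Finset.mem_filter, hcard i] at hi
        exact absurd hs hi.2) (fun S => by
        refine Finset.sum_nonpos fun i _ => ?_
        rw [hcard i, div_self hN'.ne']
        linarith [measureReal_le_one (μ := μ) (s := P i)])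
    rw [partitionCost, if_neg (not_lt.2 hk)]
    simpa using h

theorem prob_risk_gap_lt {K : ℝ} {R : Set (DataSpace d)} (hm : 3 ≤ m)
    (hK : ∀ S ⊆ R, ∀ r : ℝ, 0 ≤ r → (∀ x ∈ S, ∀ y ∈ S, dist x y ≤ r) →
      ∀ j : ℕ, ∃ T : Finset (DataSpace d), ↑T ⊆ S ∧ (T.card : ℝ) ≤ K * 2 ^ (j * m) ∧
        ∀ x ∈ S, ∃ y ∈ T, dist x y ≤ r / 2 ^ j)
    (hX : IsCompact X) (hY : IsCompact Y) (hLℓ : 0 < Lℓ)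
    (hLf : 0 < Lf) (hℓ : IsLipschitzLoss ℓ Y Lℓ) (hμ : ∀ᵐ z ∂μ, z ∈ dataDomain X Y)
    (hR : ∀ᵐ z ∂μ, z ∈ R) (hN : 0 < N) (hδ0 : 0 < δ) (hδ1 : δ ≤ 1)
    (hP : IsPartitioning P (dataDomain X Y)) {β B : ℝ} (hB : 0 ≤ B)
    (hℓB : ∀ a ∈ Y, ∀ b ∈ Y, ℓ a b ∈ Set.Icc β (β + B))
    {Ω : Type*} [MeasurableSpace Ω] (Pr : Measure Ω) [IsProbabilityMeasure Pr]
    (Z : Fin N → Ω → DataSpace d) (hZ : ∀ n, HasLaw (Z n) μ Pr) (hind : iIndepFun Z Pr)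
    (f : Ω → EuclideanSpace ℝ (Fin d) → ℝ)
    (hf : ∀ᵐ ω ∂Pr, Set.MapsTo (f ω) X Y ∧ lipConst (f ω) X ≤ ENNReal.ofReal Lf) :
    Pr {ω | ¬ (expectedRisk ℓ (f ω) μ - empiricalRisk ℓ (f ω) (fun n => Z n ω) ≤
      transportCost (4 + 5 * √(K * 2 ^ m) + 3) Lℓ m (f ω) (fun n => Z n ω) P +
        transportErr N Lℓ Lf δ P + partitionCost N k B δ)} < ENNReal.ofReal δ := by
  have hN' : (0 : ℝ) < N := by exact_mod_cast hN
  have hN1 : (1 : ℝ) ≤ N := by exact_mod_cast hN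
  have hη := one_lt_log_four_div hδ0 hδ1
  set C : ℝ := 4 + 5 * √(K * 2 ^ m) + 3 with hC
  have hC0 : 0 ≤ C := by positivity
  set η := Real.log (4 / δ) with hηdef
  set s := √(η / N) with hs
  set t := max √(2 * η / N) √((k : ℝ) / N) with ht
  have hZD : ∀ᵐ ω ∂Pr, ∀ n, Z n ω ∈ dataDomain X Y := ae_all_iff.2 fun n =>
    ae_of_ae_map (hZ n).aemeasurable (by rw [(hZ n).map_eq]; exact hμ)
  have hmap : Pr.map (fun ω n => Z n ω) = Measure.pi fun _ : Fin N => μ := by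
    rw [(iIndepFun_iff_map_fun_eq_pi_map fun n => (hZ n).aemeasurable).1 hind]
    congr 1
    ext1 n
    exact (hZ n).map_eq
  have hs2 : s ^ 2 = η / N := Real.sq_sqrt (by positivity)
  have ht0 : 0 ≤ t := le_max_of_le_left (Real.sqrt_nonneg _)
  have ht1 : 2 * s ^ 2 ≤ t ^ 2 := by
    have h1 : √(2 * η / N) ^ 2 = 2 * η / N := Real.sq_sqrt (by positivity)
    have h2 : √(2 * η / N) ^ 2 ≤ t ^ 2 := by gcongr; exact le_max_left _ _
    rw [hs2, ← mul_div_assoc]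
    linarith
  have ht2 : (k : ℝ) ≤ t ^ 2 * N := by
    have h1 : √((k : ℝ) / N) ^ 2 = k / N := Real.sq_sqrt (by positivity)
    have h2 : √((k : ℝ) / N) ^ 2 ≤ t ^ 2 := by gcongr; exact le_max_right _ _
    rwa [h1, div_le_iff₀ hN'] at h2
  -- The tail bounds need `k ≤ t N`. Otherwise `t N < k ≤ t² N` forces `t ≥ 1`, and the partition
  -- cost alone exceeds the range `B` of the loss, a trivial bound for the gap.
  rcases lt_or_ge (t * N) k with hkt | hkt
  · have hk1 : 1 < k := by
      by_contra hcon
      have hk1 : (k : ℝ) ≤ 1 := by exact_mod_cast not_lt.1 hcon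
      have hk0 : 0 < k := by
        rcases Nat.eq_zero_or_pos k with rfl | h
        · exact absurd hkt (not_lt.2 (by rw [Nat.cast_zero]; positivity))
        · exact h
      have hk1' : (1 : ℝ) ≤ k := by exact_mod_cast hk0
      nlinarith
    have ht1 : 1 ≤ t := by
      by_contra hcon
      have : t ^ 2 * N ≤ t * N := by
        gcongr
        nlinarith [not_le.1 hcon]
      linarith
    have hzero : Pr {ω | ¬ (expectedRisk ℓ (f ω) μ - empiricalRisk ℓ (f ω) (fun n => Z n ω) ≤
        transportCost C Lℓ m (f ω) (fun n => Z n ω) P +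
          transportErr N Lℓ Lf δ P + partitionCost N k B δ)} = 0 := by
      refine ae_iff.1 ?_
      filter_upwards [hf, hZD] with ω hω hD
      have h1 := risk_gap_le_range hX hY hLℓ hℓ hμ hN hω.1
        (ne_top_of_le_ne_top ENNReal.ofReal_ne_top hω.2) hD hℓB
      have h2 := transportCost_nonneg (m := m) (P := P) (f := f ω) (D := fun n => Z n ω) hC0 hLℓ.le
      have h3 := transportErr_nonneg (N := N) (Lf := Lf) (δ := δ) (P := P) hLℓ.le
      have h4 : B ≤ partitionCost N k B δ := by
        rw [partitionCost, if_pos hk1]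
        exact le_mul_of_one_le_right hB ht1
      linarith
    rw [hzero]
    exact ENNReal.ofReal_pos.2 hδ0
  · have hbad := pi_measure_not_goodSample_le hN hm hK μ hR P hP.measurableSet
      (fun i => (isBounded_dataDomain hX hY).subset (by
        rw [← hP.iUnion_eq]; exact Set.subset_iUnion P i))
      (fun i j hij => hP.disjoint i j hij) (by rw [hP.iUnion_eq]; exact hμ) (s := s) (t := t)
      (Real.sqrt_nonneg _) ht0 ht1 (by rwa [Fintype.card_fin]) (by rwa [Fintype.card_fin])
    calc _ ≤ Pr ((fun ω n => Z n ω) ⁻¹' {D | ¬ GoodSample μ P m C s t D}) := by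
          refine measure_mono_ae ?_
          filter_upwards [hf, hZD] with ω hω hD hgap hgood
          exact hgap (risk_gap_le_of_goodSample hX hY hLℓ hLf hℓ hμ hN hδ0 hδ1 hP hω.1 hω.2 hD hB
            hℓB hC0 hgood)
      _ ≤ Measure.pi (fun _ : Fin N => μ) {D | ¬ GoodSample μ P m C s t D} := by
          rw [← hmap]
          -- A good sample serves all admissible predictors at once. This inequality holds for
          -- arbitrary sets, so neither the bad event nor the dependence of `f` on `ω` has to be
          -- measurable.
          exact Measure.le_map_apply (aemeasurable_pi_lambda _ fun n => (hZ n).aemeasurable) _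
      _ ≤ ENNReal.ofReal (3 * Real.exp (-(N * s ^ 2))) := hbad
      _ < ENNReal.ofReal δ := by
          -- Three failures of probability at most `exp(-ln(4/δ)) = δ / 4` leave a strict margin.
          refine (ENNReal.ofReal_lt_ofReal_iff hδ0).2 ?_
          rw [hs2, mul_div_cancel₀ _ hN'.ne', Real.exp_neg, hηdef, Real.exp_log (by positivity),
            inv_div]
          linarith

end Risk

theorem proposition3 {d m : ℕ} (hm : 3 ≤ m)
    -- the compact `m`-dimensional `C¹` manifold, embedded in `ℝ^d × ℝ`
    {M : Type*} [TopologicalSpace M] [CompactSpace M]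
    [ChartedSpace (EuclideanSpace ℝ (Fin m)) M] [IsManifold (𝓡 m) 1 M]
    (ι : M → DataSpace d) (hι : IsSmoothEmbedding (𝓡 m) 𝓘(ℝ, DataSpace d) 1 ι) :
    ∃ C : ℝ, 0 < C ∧
      ∀ (X : Set (EuclideanSpace ℝ (Fin d))) (Y : Set ℝ), IsCompact X → IsCompact Y →
      ∀ (ℓ : ℝ → ℝ → ℝ) (Lℓ Lf : ℝ), 0 < Lℓ → 0 < Lf → IsLipschitzLoss ℓ Y Lℓ →
      ∀ (μ : Measure (DataSpace d)) [IsProbabilityMeasure μ],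
        (∀ᵐ z ∂μ, z ∈ dataDomain X Y) → (∀ᵐ z ∂μ, z ∈ Set.range ι) →
      ∀ (N : ℕ), 0 < N →
      ∀ (δ : ℝ), 0 < δ → δ ≤ 1 →
      ∀ (k : ℕ) (P : Fin k → Set (DataSpace d)), IsPartitioning P (dataDomain X Y) →
      -- the i.i.d. sample `Z` and the learned function `f`, which may depend on it
      ∀ {Ω : Type*} [MeasurableSpace Ω] (Pr : Measure Ω) [IsProbabilityMeasure Pr]
        (Z : Fin N → Ω → DataSpace d), (∀ n, HasLaw (Z n) μ Pr) → iIndepFun Z Pr →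
      ∀ (f : Ω → EuclideanSpace ℝ (Fin d) → ℝ),
        (∀ᵐ ω ∂Pr, Set.MapsTo (f ω) X Y ∧ lipConst (f ω) X ≤ ENNReal.ofReal Lf) →
        -- for a nonnegative loss
        ((∀ a ∈ Y, ∀ b ∈ Y, 0 ≤ ℓ a b) →
          Pr {ω | ¬ (expectedRisk ℓ (f ω) μ - empiricalRisk ℓ (f ω) (fun n => Z n ω) ≤
            transportCost C Lℓ m (f ω) (fun n => Z n ω) P + transportErr N Lℓ Lf δ P +
              partitionCost N k (lossSupNorm ℓ Y) δ)} < ENNReal.ofReal δ) ∧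
        -- for a loss of arbitrary sign
        Pr {ω | ¬ (expectedRisk ℓ (f ω) μ - empiricalRisk ℓ (f ω) (fun n => Z n ω) ≤
            transportCost C Lℓ m (f ω) (fun n => Z n ω) P + transportErr N Lℓ Lf δ P +
              2 * partitionCost N k (lossSupNorm ℓ Y) δ)} < ENNReal.ofReal δ := by
  obtain ⟨K, -, hK⟩ := exists_finset_net_of_isImmersion hι.isImmersion.isImmersionAt
  refine ⟨4 + 5 * √(K * 2 ^ m) + 3, by positivity, ?_⟩
  intro X Y hX hY ℓ Lℓ Lf hLℓ hLf hℓ μ _ hμ hR N hN δ hδ0 hδ1 k P hP Ω _ Pr _ Z hZ hind f hf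
  obtain ⟨z, hz⟩ := hμ.exists
  have hB : 0 ≤ lossSupNorm ℓ Y := (abs_nonneg _).trans (abs_le_lossSupNorm hY hLℓ hℓ hz.2 hz.2)
  refine ⟨fun h0 => ?_, ?_⟩
  · refine prob_risk_gap_lt hm hK hX hY hLℓ hLf hℓ hμ hR hN hδ0 hδ1 hP hB (β := 0)
      (fun a ha b hb => ⟨h0 a ha b hb, ?_⟩) Pr Z hZ hind f hf
    rw [zero_add]
    exact (le_abs_self _).trans (abs_le_lossSupNorm hY hLℓ hℓ ha hb)
  -- A signed loss ranges over an interval of length `2 ‖ℓ‖_∞`, a nonnegative one over length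
  -- `‖ℓ‖_∞`; this is the whole difference between the two bounds.
  · rw [← partitionCost_two_mul]
    refine prob_risk_gap_lt hm hK hX hY hLℓ hLf hℓ hμ hR hN hδ0 hδ1 hP (by positivity)
      (β := -lossSupNorm ℓ Y) (fun a ha b hb => ?_) Pr Z hZ hind f hf
    have h := abs_le.1 (abs_le_lossSupNorm hY hLℓ hℓ ha hb)
    exact ⟨h.1, by linarith [h.2]⟩
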